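/- There is an algorithm that, given a finite simple graph $G$ (by its adjacency matrix), computes a minimum vertex cover of $G$ in time $O^*\bigl(2.6181^{\,vc(G)-vc^*(G)}\bigr)$, that is, in at most $p(n)\cdot 2.6181^{\,vc(G)-vc^*(G)}$ steps for some fixed polynomial $p$, where $n=|V(G)|$. Here $vc(G)$ is the size of a minimum vertex cover of $G$, and $vc^*(G)$ is the optimum value of the linear programming relaxation of vertex cover: minimize $\sum_{v\in V(G)}x(v)$ subject to $x(u)+x(v)\ge 1$ for every edge $uv$ of $G$ and $x(v)\ge 0$ for every vertex $v$. (Algorithms are deterministic programs over finitely many variables holding binary trees, built from assignments, sequential composition, conditionals and while loops, in which every elementary operation, namely reading a variable, producing the empty tree, pairing two trees, taking the left or right part of a tree, assigning, or testing for the empty tree, takes one step; each of these is $O(1)$ instructions on a random access machine.) -/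

import Mathlib

/-! ### Machine model: WHILE programs over binary trees

The data are finite binary trees (cons cells and the empty tree `nil`). A program is a fixed finite
text over finitely many variables and every elementary operation (reading a variable, `nil`,
`cons`, `hd`, `tl`, an assignment, a test for `nil`) costs one unit of time. Since trees are
immutable, a random access machine that keeps them as linked cells and the variables as pointers
performs each of these operations with a constant number of instructions, so the step count below
is, up to a constant factor, running time on a (uniform cost) random access machine. -/

namespace TreeWhile

/-- The data of the machine: binary trees. -/
inductive Data : Type
  | nil : Data
  | cons : Data → Data → Data

namespace Data

/-- Left component (`nil` on `nil`). -/
def hd : Data → Data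
  | nil => nil
  | cons a _ => a

/-- Right component (`nil` on `nil`). -/
def tl : Data → Data
  | nil => nil
  | cons _ b => b

/-- A bit as a tree. -/
def ofBool : Bool → Data
  | false => nil
  | true => cons nil nil

/-- A list of trees as a tree, in the usual way as nested pairs ending in `nil`. -/
def ofList : List Data → Data
  | [] => nil
  | a :: l => cons a (ofList l)

end Data

/-- The memory: the contents of the variables, which are named by natural numbers. -/
abbrev Store : Type := ℕ → Data

/-- Expressions. -/
inductive Exp : Type
  | var : ℕ → Exp
  | nil : Exp
  | cons : Exp → Exp → Exp
  | hd : Exp → Exp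
  | tl : Exp → Exp

namespace Exp

/-- Value of an expression. -/
def eval (s : Store) : Exp → Data
  | var x => s x
  | nil => Data.nil
  | cons e f => Data.cons (e.eval s) (f.eval s)
  | hd e => (e.eval s).hd
  | tl e => (e.eval s).tl

/-- Time for evaluating an expression: one unit for each operation that occurs in it. -/
def time : Exp → ℕ
  | var _ => 1
  | nil => 1
  | cons e f => e.time + f.time + 1
  | hd e => e.time + 1
  | tl e => e.time + 1

end Exp

/-- Programs: assignment, sequential composition, conditional, loop. A test counts as true if its
value is not `nil`. -/
inductive Cmd : Type
  | assign : ℕ → Exp → Cmd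
  | seq : Cmd → Cmd → Cmd
  | cond : Exp → Cmd → Cmd → Cmd
  | loop : Exp → Cmd → Cmd

/-- `Runs c s t s'`: started in the store `s`, the program `c` halts, after exactly `t` units of
time, and the store is then `s'`. -/
inductive Runs : Cmd → Store → ℕ → Store → Prop
  | assign (x : ℕ) (e : Exp) (s : Store) :
      Runs (Cmd.assign x e) s (e.time + 1) (Function.update s x (e.eval s))
  | seq {c d : Cmd} {s s' s'' : Store} {t t' : ℕ} (h : Runs c s t s') (h' : Runs d s' t' s'') :
      Runs (Cmd.seq c d) s (t + t') s''
  | cond_true {e : Exp} {c d : Cmd} {s s' : Store} {t : ℕ} (he : e.eval s ≠ Data.nil)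
      (h : Runs c s t s') : Runs (Cmd.cond e c d) s (e.time + 1 + t) s'
  | cond_false {e : Exp} {c d : Cmd} {s s' : Store} {t : ℕ} (he : e.eval s = Data.nil)
      (h : Runs d s t s') : Runs (Cmd.cond e c d) s (e.time + 1 + t) s'
  | loop_done {e : Exp} {c : Cmd} {s : Store} (he : e.eval s = Data.nil) :
      Runs (Cmd.loop e c) s (e.time + 1) s
  | loop_step {e : Exp} {c : Cmd} {s s' s'' : Store} {t t' : ℕ} (he : e.eval s ≠ Data.nil)
      (h : Runs c s t s') (h' : Runs (Cmd.loop e c) s' t' s'') :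
      Runs (Cmd.loop e c) s (e.time + 1 + t + t') s''

/-- The machine is deterministic: the final store and the running time are determined by the
program and the initial store. -/
theorem Runs.unique {c : Cmd} {s s₁ s₂ : Store} {t₁ t₂ : ℕ} (h₁ : Runs c s t₁ s₁)
    (h₂ : Runs c s t₂ s₂) : t₁ = t₂ ∧ s₁ = s₂ := by
  induction h₁ generalizing t₂ s₂ with
  | assign x e s => cases h₂; exact ⟨rfl, rfl⟩
  | seq _ _ ih ih' =>
    cases h₂ with
    | seq k k' =>
      obtain ⟨rfl, rfl⟩ := ih k
      obtain ⟨rfl, rfl⟩ := ih' k'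
      exact ⟨rfl, rfl⟩
  | cond_true he _ ih =>
    cases h₂ with
    | cond_true _ k => obtain ⟨rfl, rfl⟩ := ih k; exact ⟨rfl, rfl⟩
    | cond_false he' _ => exact absurd he' he
  | cond_false he _ ih =>
    cases h₂ with
    | cond_true he' _ => exact absurd he he'
    | cond_false _ k => obtain ⟨rfl, rfl⟩ := ih k; exact ⟨rfl, rfl⟩
  | loop_done he =>
    cases h₂ with
    | loop_done _ => exact ⟨rfl, rfl⟩
    | loop_step he' _ _ => exact absurd he he'
  | loop_step he _ _ ih ih' =>
    cases h₂ with
    | loop_done he' => exact absurd he' he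
    | loop_step _ k k' =>
      obtain ⟨rfl, rfl⟩ := ih k
      obtain ⟨rfl, rfl⟩ := ih' k'
      exact ⟨rfl, rfl⟩

/-- Initial store: the input is in variable `0`, all other variables hold `nil`. -/
def initial (input : Data) : Store := fun x => if x = 0 then input else Data.nil

/-- On the given input the program halts after exactly `t` units of time, with the given output in
variable `0`. -/
def Outputs (c : Cmd) (input : Data) (t : ℕ) (output : Data) : Prop :=
  ∃ s : Store, Runs c (initial input) t s ∧ s 0 = output

/-- The input encoding of a graph on the vertices `0, …, n - 1`: its adjacency matrix, as the list
of its rows, each of them a list of `n` bits. -/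
noncomputable def encodeGraph {n : ℕ} (G : SimpleGraph (Fin n)) : Data :=
  open Classical in
  Data.ofList (List.ofFn fun u : Fin n =>
    Data.ofList (List.ofFn fun v : Fin n => Data.ofBool (decide (G.Adj u v))))

/-- The output encoding of a set of vertices: the list of the `n` bits of its indicator
function. -/
def encodeSet {n : ℕ} (S : Finset (Fin n)) : Data :=
  Data.ofList (List.ofFn fun v : Fin n => Data.ofBool (decide (v ∈ S)))

end TreeWhile

/-! ### The linear programming relaxation of vertex cover -/

namespace SimpleGraph

/-- Feasible solutions of LPVC(`G`), the linear programming relaxation of minimum vertex cover. -/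
def IsFractionalVertexCover {V : Type*} (G : SimpleGraph V) (x : V → ℝ) : Prop :=
  (∀ v, 0 ≤ x v) ∧ ∀ u v, G.Adj u v → 1 ≤ x u + x v

/-- `vc*(G)`, the optimum value of LPVC(`G`). The set below is nonempty and bounded below by `0`,
so this is a genuine infimum. -/
noncomputable def fractionalVertexCoverNum {V : Type*} [Fintype V] (G : SimpleGraph V) : ℝ :=
  sInf {w : ℝ | ∃ x : V → ℝ, G.IsFractionalVertexCover x ∧ w = ∑ v, x v}

end SimpleGraph

/-! Linear programming values are doubled: `lp A` is the least weight of an integral solution of `x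
u + x v ≥ 2`. A subproblem is a symmetric relation `A`, loops allowed, with twice the number `c` of
vertices already chosen, and asks for a cover `C` with `c + 2 |C| ≤ B`, where `B = 2k`. As `c + lp
A` is a lower bound for the cost, the subproblem is dropped once this exceeds `B`. Otherwise a
looped vertex is put into the cover, as is a vertex of value `2` in some optimal solution, which is
safe by the Nemhauser–Trotter exchange argument (`exists_cov_mem`).

If no such vertex remains, the all-half solution on the non-isolated vertices is the only optimum,
and every nonempty independent set of non-isolated vertices has more neighbours than elements
(`Reduced.card_lt`). Choosing `v` raises `c + lp` by at least `1`. If choosing all neighbours of `v`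
raises it by at least `2`, the algorithm branches on these two options. If not, the neighbourhood is
completed greedily to a set `W` such that the set `Z` of vertices isolated by deleting `W` satisfies
`|W| = |Z| + 1` (`Reduced.foldable`). Some minimum cover then either contains `Z` and misses `W`, or
contains `W` and misses `Z`, so `Z ∪ W` can be replaced by one merged vertex (`Foldable.hasVC_iff`)
without lowering `c + lp` (`Foldable.lp_le`).

Branching thus obeys the Fibonacci recurrence in `B - (c + lp)`, and all steps shrink the set of
non-isolated vertices, so the potential `pot` bounds the search (`kids_spec`). The base in terms of
`k - lp / 2` is the square of the golden ratio, which is below `2.6181`. Of the relation between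
`lp` and `vc*` only the easy inequality `vc* ≤ lp / 2` is needed.

The value `lp` is the size of a maximum matching in the bipartite double cover, found in polynomial
time by an auction (`card_auction`). Budgets are tried in increasing order until one succeeds, and
self-reduction then yields a minimum cover (`minCover_spec`). Running times are tracked by `PT`,
whose index type serves as a context: a sigma type adds a variable, a subtype adds a hypothesis, and
one program serves all indices. The factor `W + 1` in its time bound carries the exponential part.
-/

namespace TreeWhile

/-! ### Programs that work on a stack kept in variable `0` -/

/-- `Run c x t y`: started with `x` in variable `0`, the program `c` changes no other variable and
halts after `t` units of time with `y` in variable `0`. -/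
def Run (c : Cmd) (x : Data) (t : ℕ) (y : Data) : Prop :=
  ∀ s : Store, s 0 = x → Runs c s t (Function.update s 0 y)

theorem Run.seq {c d : Cmd} {x y z : Data} {t t' : ℕ} (h : Run c x t y) (h' : Run d y t' z) :
    Run (Cmd.seq c d) x (t + t') z := by
  intro s hs
  have := h' (Function.update s 0 y) (by simp)
  rw [Function.update_idem] at this
  exact Runs.seq (h s hs) this

theorem Run.assign {e : Exp} {x y : Data} (h : ∀ s : Store, s 0 = x → e.eval s = y) :
    Run (Cmd.assign 0 e) x (e.time + 1) y := by
  intro s hs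
  rw [← h s hs]
  exact Runs.assign 0 e s

theorem Run.cond_true {e : Exp} {c d : Cmd} {x y : Data} {t : ℕ}
    (he : ∀ s : Store, s 0 = x → e.eval s ≠ Data.nil) (h : Run c x t y) :
    Run (Cmd.cond e c d) x (e.time + 1 + t) y :=
  fun s hs => Runs.cond_true (he s hs) (h s hs)

theorem Run.cond_false {e : Exp} {c d : Cmd} {x y : Data} {t : ℕ}
    (he : ∀ s : Store, s 0 = x → e.eval s = Data.nil) (h : Run d x t y) :
    Run (Cmd.cond e c d) x (e.time + 1 + t) y :=
  fun s hs => Runs.cond_false (he s hs) (h s hs)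

theorem Run.loop_done {e : Exp} {c : Cmd} {x : Data}
    (he : ∀ s : Store, s 0 = x → e.eval s = Data.nil) :
    Run (Cmd.loop e c) x (e.time + 1) x := by
  intro s hs
  have : Function.update s 0 x = s := by rw [← hs, Function.update_eq_self]
  rw [this]
  exact Runs.loop_done (he s hs)

theorem Run.loop_step {e : Exp} {c : Cmd} {x y z : Data} {t t' : ℕ}
    (he : ∀ s : Store, s 0 = x → e.eval s ≠ Data.nil) (h : Run c x t y)
    (h' : Run (Cmd.loop e c) y t' z) : Run (Cmd.loop e c) x (e.time + 1 + t + t') z := by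
  intro s hs
  have := h' (Function.update s 0 y) (by simp)
  rw [Function.update_idem] at this
  exact Runs.loop_step (he s hs) (h s hs) this

/-- `PT n W E g`: a single program replaces the top entry `E i` of the stack by `g i`, for all
inputs `i`, in time at most `p (n i) * (W i + 1)` for a fixed polynomial `p`. -/
def PT {ι : Type} (n W : ι → ℕ) (E g : ι → Data) : Prop :=
  ∃ (c : Cmd) (p : Polynomial ℕ), ∀ i r, ∃ t, t ≤ p.eval (n i) * (W i + 1) ∧
    Run c (Data.cons (E i) r) t (Data.cons (g i) r)

/-! ### Combinators for building programs with time bounds -/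

namespace PT

open Data (cons)

variable {ι : Type} {n W : ι → ℕ} {E a b f g : ι → Data}

/-- The operation of a program on the top entry given by one assignment. -/
theorem of_exp (e : Exp) (h : ∀ i r, ∀ s : Store, s 0 = cons (E i) r → e.eval s = g i) :
    PT n W E g := by
  refine ⟨Cmd.assign 0 (Exp.cons e (Exp.tl (Exp.var 0))), Polynomial.C (e.time + 4),
    fun i r => ⟨_, ?_, Run.assign ?_⟩⟩
  · simp only [Exp.time, Polynomial.eval_C]
    nlinarith [Nat.zero_le (W i * (e.time + 4))]
  · intro s hs
    simp [Exp.eval, hs, h i r s hs, Data.tl]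

theorem id : PT n W E E :=
  of_exp (Exp.hd (Exp.var 0)) (by intro i r s hs; simp [Exp.eval, hs, Data.hd])

theorem nil : PT n W E fun _ => Data.nil :=
  of_exp Exp.nil (by intro i r s hs; rfl)

theorem pull (h : PT n W E g) {κ : Type} (φ : κ → ι) :
    PT (fun k => n (φ k)) (fun k => W (φ k)) (fun k => E (φ k)) (fun k => g (φ k)) := by
  obtain ⟨c, p, h⟩ := h
  exact ⟨c, p, fun k r => h (φ k) r⟩

theorem congr (h : PT n W E f) (hfg : ∀ i, f i = g i) : PT n W E g := by
  rwa [← funext hfg]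

theorem congr_env {E' : ι → Data} (h : PT n W E g) (hE : ∀ i, E i = E' i) : PT n W E' g := by
  rwa [← funext hE]

theorem comp (h : PT n W E f) (h' : PT n W f g) : PT n W E g := by
  obtain ⟨c, p, h⟩ := h
  obtain ⟨d, q, h'⟩ := h'
  refine ⟨Cmd.seq c d, p + q, fun i r => ?_⟩
  obtain ⟨t, ht, hr⟩ := h i r
  obtain ⟨t', ht', hr'⟩ := h' i r
  exact ⟨_, by rw [Polynomial.eval_add, add_mul]; exact add_le_add ht ht', hr.seq hr'⟩

theorem hd (h : PT n W E g) : PT n W E fun i => (g i).hd :=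
  h.comp (of_exp (Exp.hd (Exp.hd (Exp.var 0))) (by intro i r s hs; simp [Exp.eval, hs, Data.hd]))

theorem tl (h : PT n W E g) : PT n W E fun i => (g i).tl :=
  h.comp (of_exp (Exp.tl (Exp.hd (Exp.var 0))) (by intro i r s hs; simp [Exp.eval, hs, Data.hd]))

theorem here : PT n W (fun i => cons (a i) (E i)) a := id.hd

theorem there (h : PT n W E g) : PT n W (fun i => cons (a i) (E i)) g := id.tl.comp h

theorem cons (hf : PT n W E f) (hg : PT n W E g) : PT n W E fun i => cons (f i) (g i) := by
  obtain ⟨c, p, hf⟩ := hf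
  obtain ⟨d, q, hg⟩ := hg
  let v := Exp.var 0
  -- Each program consumes the environment on top of the stack, so a copy is made first; the middle
  -- assignment brings the saved copy back above the value of `f`.
  refine ⟨Cmd.seq (Cmd.assign 0 (Exp.cons (Exp.hd v) v)) (Cmd.seq c (Cmd.seq
    (Cmd.assign 0 (Exp.cons (Exp.hd (Exp.tl v)) (Exp.cons (Exp.hd v) (Exp.tl (Exp.tl v)))))
    (Cmd.seq d (Cmd.assign 0
      (Exp.cons (Exp.cons (Exp.hd (Exp.tl v)) (Exp.hd v)) (Exp.tl (Exp.tl v))))))),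
    p + q + Polynomial.C 30, fun i r => ?_⟩
  obtain ⟨t, ht, hr⟩ := hf i (Data.cons (E i) r)
  obtain ⟨t', ht', hr'⟩ := hg i (Data.cons (f i) r)
  refine ⟨_, ?_, Run.seq (Run.assign (y := Data.cons (E i) (Data.cons (E i) r)) ?_)
    (hr.seq (Run.seq (Run.assign (y := Data.cons (E i) (Data.cons (f i) r)) ?_)
      (hr'.seq (Run.assign ?_))))⟩
  · simp only [Exp.time, v, Polynomial.eval_add, Polynomial.eval_C, add_mul]
    nlinarith
  all_goals intro s hs; simp [Exp.eval, hs, Data.hd, Data.tl, v]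

theorem letIn (h : PT n W E f) (h' : PT n W (fun i => Data.cons (f i) (E i)) g) : PT n W E g :=
  (h.cons id).comp h'

/-- Removing the second entry of an environment. -/
theorem skip (h : PT n W (fun i => Data.cons (a i) (E i)) g) :
    PT n W (fun i => Data.cons (a i) (Data.cons (b i) (E i))) g :=
  (here.cons id.tl.tl).comp h

/-- Passing to a context with one more variable. -/
theorem up {β : ι → Type} {a : (Σ i, β i) → Data} (h : PT n W E g) :
    PT (fun p : Σ i, β i => n p.1) (fun p => W p.1) (fun p => Data.cons (a p) (E p.1))
      fun p => g p.1 := (h.pull Sigma.fst).there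

/-- Passing to a context with one more hypothesis. -/
theorem sub {q : ι → Prop} (h : PT n W E g) :
    PT (fun i : {i // q i} => n i) (fun i => W i) (fun i => E i) fun i => g i :=
  h.pull Subtype.val

/-- Passing to another context with one more entry in the environment. -/
theorem pull1 (h : PT n W E g) {κ : Type} (φ : κ → ι) {a : κ → Data} :
    PT (fun k => n (φ k)) (fun k => W (φ k)) (fun k => Data.cons (a k) (E (φ k)))
      fun k => g (φ k) := (h.pull φ).there

/-- Passing to another context with two more entries in the environment. -/
theorem pull2 (h : PT n W E g) {κ : Type} (φ : κ → ι) {a b : κ → Data} :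
    PT (fun k => n (φ k)) (fun k => W (φ k))
      (fun k => Data.cons (a k) (Data.cons (b k) (E (φ k)))) fun k => g (φ k) :=
  (h.pull φ).there.there

/-- Case distinction. -/
theorem cases {h : ι → Data} {b : ι → Bool} (hb : PT n W E fun i => Data.ofBool (b i))
    (h1 : PT (ι := {i // b i = true}) (fun i => n i) (fun i => W i) (fun i => E i) fun i => h i)
    (h0 : PT (ι := {i // b i = false}) (fun i => n i) (fun i => W i) (fun i => E i) fun i => h i) :
    PT n W E h := by
  obtain ⟨c, p, hb⟩ := hb
  obtain ⟨c1, p1, h1⟩ := h1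
  obtain ⟨c0, p0, h0⟩ := h0
  let v := Exp.var 0
  let pop := Cmd.assign 0 (Exp.tl v)
  refine ⟨Cmd.seq (Cmd.assign 0 (Exp.cons (Exp.hd v) v)) (Cmd.seq c
    (Cmd.cond (Exp.hd v) (Cmd.seq pop c1) (Cmd.seq pop c0))), p + p1 + p0 + Polynomial.C 30,
    fun i r => ?_⟩
  obtain ⟨t, ht, hr⟩ := hb i (Data.cons (E i) r)
  have hdup : Run (Cmd.assign 0 (Exp.cons (Exp.hd v) v)) (Data.cons (E i) r) _
      (Data.cons (E i) (Data.cons (E i) r)) :=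
    Run.assign (by intro s hs; simp [Exp.eval, hs, Data.hd, v])
  have hpop : Run pop (Data.cons (Data.ofBool (b i)) (Data.cons (E i) r)) _
      (Data.cons (E i) r) :=
    Run.assign (by intro s hs; simp [Exp.eval, hs, Data.tl, v])
  cases hbi : b i with
  | true =>
    obtain ⟨t', ht', hr'⟩ := h1 ⟨i, hbi⟩ r
    refine ⟨_, ?_, hdup.seq (hr.seq (Run.cond_true ?_ (hpop.seq hr')))⟩
    · simp only [Exp.time, v, Polynomial.eval_add, Polynomial.eval_C, add_mul]
      nlinarith [Nat.zero_le (p0.eval (n i) * W i)]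
    · intro s hs; simp [Exp.eval, hs, Data.hd, v, hbi, Data.ofBool]
  | false =>
    obtain ⟨t', ht', hr'⟩ := h0 ⟨i, hbi⟩ r
    refine ⟨_, ?_, hdup.seq (hr.seq (Run.cond_false ?_ (hpop.seq hr')))⟩
    · simp only [Exp.time, v, Polynomial.eval_add, Polynomial.eval_C, add_mul]
      nlinarith [Nat.zero_le (p1.eval (n i) * W i)]
    · intro s hs; simp [Exp.eval, hs, Data.hd, v, hbi, Data.ofBool]

/-- A loop that runs through the states `X i (K i), …, X i 0`, and ends when the first component of
the state is `nil`. -/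
theorem loop {V : ι → ℕ} {K : ι → ℕ} {X : ι → ℕ → Data} (q : Polynomial ℕ)
    (hK : ∀ i, (K i + 1) * (V i + 1) ≤ q.eval (n i) * (W i + 1))
    (h0 : ∀ i, (X i 0).hd = Data.nil) (h1 : ∀ i j, j < K i → (X i (j + 1)).hd ≠ Data.nil)
    (h : PT (ι := Σ i, Fin (K i)) (fun p => n p.1) (fun p => V p.1)
      (fun p => X p.1 (p.2 + 1)) fun p => X p.1 p.2) :
    PT n W (fun i => X i (K i)) fun i => X i 0 := by
  obtain ⟨c, p, h⟩ := h
  refine ⟨Cmd.loop (Exp.hd (Exp.hd (Exp.var 0))) c, (p + Polynomial.C 4) * q, fun i r => ?_⟩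
  -- `V` is the budget of one round and `W` that of the whole loop. Later uses take either `V = W`
  -- with polynomially many rounds, or `V = 0` with about `W` rounds.
  have key : ∀ k, k ≤ K i → ∃ t, t ≤ (k + 1) * ((p.eval (n i) + 4) * (V i + 1)) ∧
      Run (Cmd.loop (Exp.hd (Exp.hd (Exp.var 0))) c) (Data.cons (X i k) r) t
        (Data.cons (X i 0) r) := by
    intro k
    induction k with
    | zero =>
      intro _
      refine ⟨_, ?_, Run.loop_done ?_⟩
      · simp only [Exp.time]
        nlinarith [Nat.zero_le (p.eval (n i) * V i), Nat.zero_le (p.eval (n i))]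
      · intro s hs; simp [Exp.eval, hs, Data.hd]; exact h0 i
    | succ k ih =>
      intro hk
      obtain ⟨t', ht', hr'⟩ := ih (by omega)
      obtain ⟨t, ht, hr⟩ := h ⟨i, ⟨k, hk⟩⟩ r
      refine ⟨_, ?_, Run.loop_step ?_ hr hr'⟩
      · simp only [Exp.time] at *
        nlinarith
      · intro s hs; simp [Exp.eval, hs, Data.hd]; exact h1 i k hk
  obtain ⟨t, ht, hr⟩ := key (K i) le_rfl
  refine ⟨t, ht.trans ?_, hr⟩
  simp only [Polynomial.eval_mul, Polynomial.eval_add, Polynomial.eval_C]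
  calc (K i + 1) * ((p.eval (n i) + 4) * (V i + 1))
      = (p.eval (n i) + 4) * ((K i + 1) * (V i + 1)) := by ring
    _ ≤ (p.eval (n i) + 4) * (q.eval (n i) * (W i + 1)) := Nat.mul_le_mul_left _ (hK i)
    _ = _ := by ring

end PT

/-! ### Encodings of numbers, vectors, matrices and sets -/

/-- Unary encoding of a natural number. -/
def num : ℕ → Data
  | 0 => Data.nil
  | k + 1 => Data.cons Data.nil (num k)

/-- Encoding of a vector. -/
def vec {m : ℕ} (f : Fin m → Data) : Data := Data.ofList (List.ofFn f)

/-- Encoding of a matrix of bits. -/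
def mat {m : ℕ} (A : Fin m → Fin m → Bool) : Data :=
  vec fun u => vec fun v => Data.ofBool (A u v)

/-- The first index with the given property. -/
def findFin {m : ℕ} (P : Fin m → Bool) : Option (Fin m) := (List.finRange m).find? P

theorem findFin_some {m : ℕ} {P : Fin m → Bool} {j : Fin m} (h : findFin P = some j) :
    P j = true := List.find?_some h

theorem findFin_none {m : ℕ} {P : Fin m → Bool} (h : findFin P = none) (j : Fin m) :
    P j = false := by
  have := List.find?_eq_none.1 h j (List.mem_finRange j)
  simpa using this

/-! ### Programs for arithmetic, logic, vectors, sets and searches -/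

namespace PT

variable {ι : Type} {n W : ι → ℕ} {E a b f g : ι → Data}

/-- Counting a number down to zero. -/
theorem down {K : ι → ℕ} {s : ι → ℕ → Data} (q : Polynomial ℕ) (hq : ∀ i, K i ≤ q.eval (n i))
    (hK : PT n W E fun i => num (K i)) (h0 : PT n W E fun i => s i (K i))
    (hs : PT (ι := Σ i, Fin (K i)) (fun p => n p.1) (fun p => W p.1)
      (fun p => Data.cons (num p.2) (Data.cons (s p.1 (p.2 + 1)) (E p.1))) fun p => s p.1 p.2) :
    PT n W E fun i => s i 0 := by
  have hl : PT n W (fun i => Data.cons (num (K i)) (Data.cons (s i (K i)) (E i)))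
      (fun i => Data.cons (num 0) (Data.cons (s i 0) (E i))) := by
    refine loop (V := W) (K := K) (X := fun i j => Data.cons (num j) (Data.cons (s i j) (E i)))
      (q + 1) (fun i => ?_) (fun i => rfl) ?_ ?_
    · rw [Polynomial.eval_add, Polynomial.eval_one]
      exact Nat.mul_le_mul_right _ (Nat.succ_le_succ (hq i))
    · intro i j _; simp [num, Data.hd]
    · have := id.hd.tl.cons (n := fun p : Σ i, Fin (K i) => n p.1) (W := fun p => W p.1)
        (E := fun p => Data.cons (num (p.2 + 1)) (Data.cons (s p.1 (p.2 + 1)) (E p.1)))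
        id.tl
      exact this.comp (here.cons (hs.cons id.tl.tl))
  exact ((hK.cons (h0.cons id)).comp hl).comp id.tl.hd

theorem ofBool_const (b : Bool) : PT n W E fun _ => Data.ofBool b := by
  cases b
  · exact nil
  · exact nil.cons nil

theorem succ {k : ι → ℕ} (h : PT n W E fun i => num (k i)) : PT n W E fun i => num (k i + 1) :=
  nil.cons h

/-- Addition; the first summand has to be polynomially bounded. -/
theorem add {k l : ι → ℕ} (q : Polynomial ℕ) (hq : ∀ i, k i ≤ q.eval (n i))
    (hk : PT n W E fun i => num (k i)) (hl : PT n W E fun i => num (l i)) :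
    PT n W E fun i => num (k i + l i) := by
  refine (down (s := fun i j => num (k i - j + l i)) q hq hk (hl.congr fun i => by simp)
    ?_).congr fun i => by simp
  refine (here.there.succ).congr fun p => ?_
  have := p.2.2
  congr 1; omega

theorem two_mul {k : ι → ℕ} (q : Polynomial ℕ) (hq : ∀ i, k i ≤ q.eval (n i))
    (hk : PT n W E fun i => num (k i)) : PT n W E fun i => num (2 * k i) :=
  (add q hq hk hk).congr fun i => by rw [_root_.two_mul]

theorem not {b : ι → Bool} (h : PT n W E fun i => Data.ofBool (b i)) :
    PT n W E fun i => Data.ofBool (!b i) :=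
  cases h ((ofBool_const false).congr fun i => by simp [i.2])
    ((ofBool_const true).congr fun i => by simp [i.2])

theorem and {b c : ι → Bool} (h : PT n W E fun i => Data.ofBool (b i))
    (h' : PT n W E fun i => Data.ofBool (c i)) : PT n W E fun i => Data.ofBool (b i && c i) :=
  cases h ((h'.pull Subtype.val).congr fun i => by simp [i.2])
    ((ofBool_const false).congr fun i => by simp [i.2])

theorem or {b c : ι → Bool} (h : PT n W E fun i => Data.ofBool (b i))
    (h' : PT n W E fun i => Data.ofBool (c i)) : PT n W E fun i => Data.ofBool (b i || c i) :=
  cases h ((ofBool_const true).congr fun i => by simp [i.2])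
    ((h'.pull Subtype.val).congr fun i => by simp [i.2])

theorem ite {b : ι → Bool} (h : PT n W E fun i => Data.ofBool (b i)) (hf : PT n W E f)
    (hg : PT n W E g) : PT n W E fun i => if b i then f i else g i :=
  cases h ((hf.pull Subtype.val).congr fun i => by simp [i.2])
    ((hg.pull Subtype.val).congr fun i => by simp [i.2])

/-- Test for `nil`, converting any tree to a bit. -/
theorem isNil (h : PT n W E f) {b : ι → Bool} (hb : ∀ i, b i = true ↔ f i = Data.nil) :
    PT n W E fun i => Data.ofBool (b i) := by
  obtain ⟨c, p, h⟩ := h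
  let v := Exp.var 0
  refine ⟨Cmd.seq c (Cmd.cond (Exp.hd v)
    (Cmd.assign 0 (Exp.cons Exp.nil (Exp.tl v)))
    (Cmd.assign 0 (Exp.cons (Exp.cons Exp.nil Exp.nil) (Exp.tl v)))), p + Polynomial.C 20,
    fun i r => ?_⟩
  obtain ⟨t, ht, hr⟩ := h i r
  cases hbi : b i with
  | true =>
    refine ⟨_, ?_, hr.seq (Run.cond_false ?_ (Run.assign ?_))⟩
    · simp only [Exp.time, v, Polynomial.eval_add, Polynomial.eval_C, add_mul]
      nlinarith
    · intro s hs; simp [Exp.eval, hs, Data.hd, v, (hb i).1 hbi]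
    · intro s hs; simp [Exp.eval, hs, Data.tl, v, hbi, Data.ofBool]
  | false =>
    refine ⟨_, ?_, hr.seq (Run.cond_true ?_ (Run.assign ?_))⟩
    · simp only [Exp.time, v, Polynomial.eval_add, Polynomial.eval_C, add_mul]
      nlinarith
    · intro s hs
      have : f i ≠ Data.nil := fun h => by simp [(hb i).2 h] at hbi
      simp [Exp.eval, hs, Data.hd, v, this]
    · intro s hs; simp [Exp.eval, hs, Data.tl, v, hbi, Data.ofBool]

/-- Comparison of numbers; the second has to be polynomially bounded. -/
theorem le {k l : ι → ℕ} (q : Polynomial ℕ) (hq : ∀ i, l i ≤ q.eval (n i))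
    (hk : PT n W E fun i => num (k i)) (hl : PT n W E fun i => num (l i)) :
    PT n W E fun i => Data.ofBool (decide (k i ≤ l i)) := by
  -- Removing one cell `l i` times computes the truncated difference, which is `nil` exactly when
  -- the comparison holds.
  refine isNil (down (s := fun i j => num (k i - (l i - j))) q hq hl (hk.congr fun i => by simp)
    ?_) fun i => ?_
  · refine (here.there.tl).congr fun p => ?_
    have := p.2.2
    have h : k p.1 - (l p.1 - p.2) = k p.1 - (l p.1 - (p.2 + 1)) - 1 := by omega
    rw [h]
    cases k p.1 - (l p.1 - (p.2 + 1)) <;> rfl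
  · rcases h : k i - (l i - 0) with _ | m
    · simp [num]; omega
    · simp [num]; omega

theorem lt {k l : ι → ℕ} (q : Polynomial ℕ) (hq : ∀ i, k i ≤ q.eval (n i))
    (hk : PT n W E fun i => num (k i)) (hl : PT n W E fun i => num (l i)) :
    PT n W E fun i => Data.ofBool (decide (k i < l i)) :=
  (le q hq hl hk).not.congr fun i => by congr 1; rw [← decide_not, decide_eq_decide]; exact Nat.not_le

theorem num_fin {m : ι → ℕ} (hm : ∀ i, m i ≤ n i) (j : ∀ i, Fin (m i)) :
    ∀ i, ((j i : ℕ)) ≤ (Polynomial.X : Polynomial ℕ).eval (n i) := fun i => by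
  rw [Polynomial.eval_X]; exact ((j i).2.le).trans (hm i)

/-- Equality of indices. -/
theorem finEq {j k : ∀ i, Fin (n i)} (hj : PT n W E fun i => num (j i))
    (hk : PT n W E fun i => num (k i)) : PT n W E fun i => Data.ofBool (decide (j i = k i)) :=
  ((le Polynomial.X (num_fin (fun _ => le_rfl) k) hj hk).and
    (le Polynomial.X (num_fin (fun _ => le_rfl) j) hk hj)).congr fun i => by
      congr 1
      rw [← Bool.decide_and, decide_eq_decide, Fin.ext_iff]
      omega

/-- Recursion along the list of all indices. -/
theorem foldr {α : ι → Type} {op : ∀ i, Fin (n i) → α i → α i} {init : ∀ i, α i}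
    (enc : ∀ i, α i → Data)
    (hn : PT n W E fun i => num (n i)) (h0 : PT n W E fun i => enc i (init i))
    (hs : PT (ι := Σ i, Fin (n i) × α i) (fun p => n p.1) (fun p => W p.1)
      (fun p => Data.cons (num p.2.1) (Data.cons (enc p.1 p.2.2) (E p.1)))
      fun p => enc p.1 (op p.1 p.2.1 p.2.2)) :
    PT n W E fun i => enc i ((List.finRange (n i)).foldr (op i) (init i)) := by
  -- Counting down meets the last index first, which is the order in which `foldr` evaluates, and
  -- the counter is itself the current index.
  refine (down (s := fun i j => enc i (((List.finRange (n i)).drop j).foldr (op i) (init i)))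
    Polynomial.X (fun i => by simp) hn (h0.congr fun i => ?_) ?_).congr fun i => by simp
  · rw [List.drop_of_length_le (by simp)]; rfl
  · refine (hs.pull (κ := Σ i, Fin (n i)) fun p => ⟨p.1, p.2,
      ((List.finRange (n p.1)).drop (p.2 + 1)).foldr (op p.1) (init p.1)⟩).congr fun p => ?_
    simp only []
    rw [List.drop_eq_getElem_cons (i := p.2) (by simp)]
    simp

theorem ofList_map_finRange {m : ℕ} (f : Fin m → Data) :
    vec f = (List.finRange m).foldr (fun j l => Data.cons (f j) l) Data.nil := by
  rw [vec, List.ofFn_eq_map]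
  induction List.finRange m with
  | nil => rfl
  | cons x l ih => simp [Data.ofList, ih]

/-- Tabulation of a vector. -/
theorem tab {f : ∀ i, Fin (n i) → Data} (hn : PT n W E fun i => num (n i))
    (h : PT (ι := Σ i, Fin (n i)) (fun p => n p.1) (fun p => W p.1)
      (fun p => Data.cons (num p.2) (E p.1)) fun p => f p.1 p.2) :
    PT n W E fun i => vec (f i) := by
  refine (foldr (α := fun _ => Data) (op := fun i j l => Data.cons (f i j) l)
    (init := fun _ => Data.nil) (fun _ d => d) hn nil ?_).congr
      fun i => (ofList_map_finRange _).symm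
  exact (h.pull (κ := Σ i, Fin (n i) × Data) fun p => ⟨p.1, p.2.1⟩).skip.cons here.there

/-- Existential quantification over indices. -/
theorem ex {P : ∀ i, Fin (n i) → Bool} (hn : PT n W E fun i => num (n i))
    (h : PT (ι := Σ i, Fin (n i)) (fun p => n p.1) (fun p => W p.1)
      (fun p => Data.cons (num p.2) (E p.1)) fun p => Data.ofBool (P p.1 p.2)) :
    PT n W E fun i => Data.ofBool (decide (∃ j, P i j = true)) := by
  refine (foldr (α := fun _ => Bool) (op := fun i j l => P i j || l)
    (init := fun _ => false) (fun _ d => Data.ofBool d) hn nil ?_).congr fun i => ?_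
  · exact (h.pull (κ := Σ i, Fin (n i) × Bool) fun p => ⟨p.1, p.2.1⟩).skip.or here.there
  · congr 1
    have : ∀ l : List (Fin (n i)), l.foldr (fun j l => P i j || l) false =
        decide (∃ j ∈ l, P i j = true) := by
      intro l
      induction l with
      | nil => simp
      | cons x l ih => rw [List.foldr_cons, ih]; simp
    rw [this]; simp

/-- Universal quantification over indices. -/
theorem all {P : ∀ i, Fin (n i) → Bool} (hn : PT n W E fun i => num (n i))
    (h : PT (ι := Σ i, Fin (n i)) (fun p => n p.1) (fun p => W p.1)
      (fun p => Data.cons (num p.2) (E p.1)) fun p => Data.ofBool (P p.1 p.2)) :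
    PT n W E fun i => Data.ofBool (decide (∀ j, P i j = true)) :=
  (ex (P := fun i j => !P i j) hn h.not).not.congr fun i => by
    congr 1; rw [← decide_not, decide_eq_decide]; simp

/-- Counting indices. -/
theorem count {P : ∀ i, Fin (n i) → Bool} (hn : PT n W E fun i => num (n i))
    (h : PT (ι := Σ i, Fin (n i)) (fun p => n p.1) (fun p => W p.1)
      (fun p => Data.cons (num p.2) (E p.1)) fun p => Data.ofBool (P p.1 p.2)) :
    PT n W E fun i => num (Finset.univ.filter fun j => P i j = true).card := by
  refine (foldr (α := fun _ => ℕ) (op := fun i j l => if P i j then l + 1 else l)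
    (init := fun _ => 0) (fun _ d => num d) hn nil ?_).congr fun i => ?_
  · exact (((h.pull (κ := Σ i, Fin (n i) × ℕ) fun p => ⟨p.1, p.2.1⟩).skip).ite
      (here.there.succ) here.there).congr fun p => by split_ifs <;> rfl
  · congr 1
    have : ∀ l : List (Fin (n i)), l.foldr (fun j l => if P i j then l + 1 else l) 0 =
        l.countP (P i) := by
      intro l
      induction l with
      | nil => simp
      | cons x l ih => rw [List.foldr_cons, ih, List.countP_cons]; split_ifs <;> rfl
    rw [this, List.countP_eq_length_filter, ← List.toFinset_card_of_nodup]
    · congr 1; ext; simp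
    · exact (List.nodup_finRange _).filter _

/-- Case distinction on the result of a search. -/
theorem findCase {h : ι → Data} {P : ∀ i, Fin (n i) → Bool} (hn : PT n W E fun i => num (n i))
    (hP : PT (ι := Σ i, Fin (n i)) (fun p => n p.1) (fun p => W p.1)
      (fun p => Data.cons (num p.2) (E p.1)) fun p => Data.ofBool (P p.1 p.2))
    (h0 : PT (ι := {i // findFin (P i) = none}) (fun i => n i) (fun i => W i) (fun i => E i)
      fun i => h i)
    (h1 : PT (ι := {p : Σ i, Fin (n i) // findFin (P p.1) = some p.2}) (fun p => n p.1.1)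
      (fun p => W p.1.1) (fun p => Data.cons (num p.1.2) (E p.1.1)) fun p => h p.1.1) :
    PT n W E h := by
  let enc : ∀ i, Option (Fin (n i)) → Data := fun i o =>
    match o with
    | none => Data.nil
    | some j => Data.cons (num j) Data.nil
  have hf : PT n W E fun i => enc i (findFin (P i)) := by
    refine (foldr (op := fun i j o => if P i j then some j else o) (init := fun _ => none) enc hn
      nil ?_).congr fun i => ?_
    · exact (((hP.pull (κ := Σ i, Fin (n i) × Option (Fin (n i))) fun p => ⟨p.1, p.2.1⟩).skip).ite
        (here.cons nil) here.there).congr fun p => by split_ifs <;> rfl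
    · congr 1
      rw [findFin]
      induction List.finRange (n i) with
      | nil => rfl
      | cons x l ih => rw [List.foldr_cons, ih, List.find?_cons]; cases P i x <;> simp
  refine letIn hf (cases (b := fun i => (findFin (P i)).isNone) (isNil here fun i => ?_) ?_ ?_)
  · cases findFin (P i) <;> simp [enc]
  · exact (h0.pull (κ := {i // (findFin (P i)).isNone = true})
      fun i => ⟨i.1, by simpa using i.2⟩).there
  · have hi : ∀ i : {i // (findFin (P i)).isNone = false}, (findFin (P i.1)).isSome = true :=
      fun i => by have := i.2; rwa [← Option.not_isSome, Bool.not_eq_false'] at this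
    refine ((here.hd).cons id.tl).comp ((h1.pull (κ := {i // (findFin (P i)).isNone = false})
      fun i => ⟨⟨i.1, (findFin (P i.1)).get (hi i)⟩, by simp⟩).congr_env fun i => ?_)
    simp only []
    congr 1
    conv_rhs => rw [← Option.some_get (hi i)]
    rfl

/-- Access to an entry of a vector. -/
theorem get {f : ∀ i, Fin (n i) → Data} {j : ∀ i, Fin (n i)}
    (hf : PT n W E fun i => vec (f i)) (hj : PT n W E fun i => num (j i)) :
    PT n W E fun i => f i (j i) := by
  have h := (down (s := fun i k => Data.ofList ((List.ofFn (f i)).drop (j i - k))) Polynomial.X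
    (num_fin (fun _ => le_rfl) j) hj (hf.congr fun i => by simp [vec]) ?_).hd
  · refine h.congr fun i => ?_
    rw [Nat.sub_zero, List.drop_eq_getElem_cons (by simp)]
    simp [Data.ofList, Data.hd]
  · refine here.there.tl.congr fun p => ?_
    have h1 := p.2.2
    have h2 := (j p.1).2
    have : (j p.1 : ℕ) - p.2 = (j p.1 - (p.2 + 1)) + 1 := by omega
    rw [this, List.drop_eq_getElem_cons (by simp; omega)]
    simp [Data.ofList, Data.tl]

theorem matGet {A : ∀ i, Fin (n i) → Fin (n i) → Bool} {u v : ∀ i, Fin (n i)}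
    (hA : PT n W E fun i => mat (A i)) (hu : PT n W E fun i => num (u i))
    (hv : PT n W E fun i => num (v i)) : PT n W E fun i => Data.ofBool (A i (u i) (v i)) :=
  get (f := fun i w => Data.ofBool (A i (u i) w)) (get hA hu) hv

/-- Tabulation of a matrix. -/
theorem matTab {A : ∀ i, Fin (n i) → Fin (n i) → Bool} (hn : PT n W E fun i => num (n i))
    (h : PT (ι := Σ i, Fin (n i) × Fin (n i)) (fun p => n p.1) (fun p => W p.1)
      (fun p => Data.cons (num p.2.2) (Data.cons (num p.2.1) (E p.1)))
      fun p => Data.ofBool (A p.1 p.2.1 p.2.2)) :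
    PT n W E fun i => mat (A i) :=
  tab hn (tab (n := fun p : Σ i, Fin (n i) => n p.1) (hn.pull Sigma.fst).there
    (h.pull (κ := Σ p : Σ i, Fin (n i), Fin (n p.1)) fun p => ⟨p.1.1, p.1.2, p.2⟩))

theorem mem {S : ∀ i, Finset (Fin (n i))} {u : ∀ i, Fin (n i)}
    (hS : PT n W E fun i => encodeSet (S i)) (hu : PT n W E fun i => num (u i)) :
    PT n W E fun i => Data.ofBool (decide (u i ∈ S i)) :=
  get (f := fun i v => Data.ofBool (decide (v ∈ S i))) hS hu

theorem setTab {S : ∀ i, Finset (Fin (n i))} (hn : PT n W E fun i => num (n i))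
    (h : PT (ι := Σ i, Fin (n i)) (fun p => n p.1) (fun p => W p.1)
      (fun p => Data.cons (num p.2) (E p.1)) fun p => Data.ofBool (decide (p.2 ∈ S p.1))) :
    PT n W E fun i => encodeSet (S i) :=
  tab hn h

theorem card {S : ∀ i, Finset (Fin (n i))} (hn : PT n W E fun i => num (n i))
    (hS : PT n W E fun i => encodeSet (S i)) : PT n W E fun i => num (S i).card := by
  refine (count (P := fun i j => decide (j ∈ S i)) hn
    (mem ((hS.pull Sigma.fst).there) here)).congr fun i => ?_
  congr 2
  ext; simp

/-- A loop whose number of iterations is bounded by a decreasing measure. -/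
theorem whileLoop {σ : ι → Type} {st : ∀ i, σ i → Data} {next : ∀ i, σ i → σ i}
    {inv : ∀ i, σ i → Prop} {meas : ∀ i, σ i → ℕ} {init : ∀ i, σ i} {g : ι → Data}
    (h0 : PT n W E fun i => st i (init i))
    (hinv0 : ∀ i, inv i (init i))
    (hinv : ∀ i s, inv i s → (st i s).hd ≠ Data.nil → inv i (next i s))
    (hmeas : ∀ i s, inv i s → (st i s).hd ≠ Data.nil → meas i (next i s) < meas i s)
    (q : Polynomial ℕ) (hW : ∀ i, meas i (init i) + 1 ≤ q.eval (n i) * (W i + 1))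
    (hg : ∀ i s, inv i s → (st i s).hd = Data.nil → st i s = g i)
    (hs : PT (ι := {p : Σ i, σ i // inv p.1 p.2 ∧ (st p.1 p.2).hd ≠ Data.nil})
      (fun p => n p.1.1) (fun _ => 0) (fun p => st p.1.1 p.1.2)
      fun p => st p.1.1 (next p.1.1 p.1.2)) :
    PT n W E g := by
  -- A run that never stops would lower the measure more often than its initial value allows.
  have hhalt : ∀ i, ∃ N, (st i ((next i)^[N] (init i))).hd = Data.nil := by
    intro i
    by_contra hcon
    push Not at hcon
    have : ∀ N, inv i ((next i)^[N] (init i)) ∧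
        meas i ((next i)^[N] (init i)) + N ≤ meas i (init i) := by
      intro N
      induction N with
      | zero => exact ⟨hinv0 i, le_rfl⟩
      | succ N ih =>
        rw [Function.iterate_succ_apply']
        have := hmeas i _ ih.1 (hcon N)
        exact ⟨hinv i _ ih.1 (hcon N), by omega⟩
    have := (this (meas i (init i) + 1)).2
    omega
  classical
  let N := fun i => Nat.find (hhalt i)
  have hN : ∀ i k, k ≤ N i → inv i ((next i)^[k] (init i)) ∧
        meas i ((next i)^[k] (init i)) + k ≤ meas i (init i) := by
    intro i k
    induction k with
    | zero => exact fun _ => ⟨hinv0 i, le_rfl⟩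
    | succ k ih =>
      intro hk
      have h1 := Nat.find_min (hhalt i) (m := k) (by exact hk)
      have ih := ih (by omega)
      rw [Function.iterate_succ_apply']
      have := hmeas i _ ih.1 h1
      exact ⟨hinv i _ ih.1 h1, by omega⟩
  have hl : PT n W (fun i => st i ((next i)^[N i - N i] (init i)))
      fun i => st i ((next i)^[N i - 0] (init i)) := by
    -- With `V = 0` each round is polynomial, so the whole budget pays for the number of rounds.
    refine loop (V := fun _ => 0) (K := N)
      (X := fun i j => st i ((next i)^[N i - j] (init i))) q ?_ ?_ ?_ ?_
    · intro i
      have := (hN i (N i) le_rfl).2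
      have := hW i
      simp only [zero_add, mul_one]
      omega
    · intro i
      exact Nat.find_spec (hhalt i)
    · intro i j hj
      exact Nat.find_min (hhalt i) (m := N i - (j + 1)) (by show _ < N i; omega)
    · refine (hs.pull (κ := Σ i, Fin (N i)) fun p =>
        ⟨⟨p.1, (next p.1)^[N p.1 - (p.2 + 1)] (init p.1)⟩, (hN p.1 _ (by omega)).1,
          Nat.find_min (hhalt p.1) (by show _ < N p.1; have := p.2.2; omega)⟩).congr fun p => ?_
      simp only []
      rw [← Function.iterate_succ_apply' (next p.1)]
      have := p.2.2
      congr 2; omega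
  refine ((h0.congr fun i => by simp).comp hl).congr fun i => ?_
  exact hg i _ (hN i _ (by omega)).1 (Nat.find_spec (hhalt i))

end PT

end TreeWhile

/-! ### Vertex covers and two-covers of symmetric relations -/

set_option linter.unusedSectionVars false

namespace VertexCover

open Finset

variable {V : Type} [Fintype V] [DecidableEq V]

/-- A symmetric relation, that is, an undirected graph which may have loops. -/
def Sym (A : V → V → Bool) : Prop := ∀ u v, A u v = A v u

/-- Deletion of a set of vertices (which stay as isolated vertices). -/
def del (A : V → V → Bool) (S : Finset V) (u v : V) : Bool :=
  A u v && (!decide (u ∈ S) && !decide (v ∈ S))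

/-- The set of neighbours of a vertex. -/
def nbr (A : V → V → Bool) (v : V) : Finset V := univ.filter fun u => A v u = true

/-- The set of vertices that are not isolated. -/
def supp (A : V → V → Bool) : Finset V := univ.filter fun u => ∃ v, A u v = true

/-- Vertex covers. -/
def Cov (A : V → V → Bool) (C : Finset V) : Prop := ∀ u v, A u v = true → u ∈ C ∨ v ∈ C

/-- Integral solutions of the linear program for vertex cover, scaled by two. -/
def TwoCover (A : V → V → Bool) (x : V → ℕ) : Prop := ∀ u v, A u v = true → 2 ≤ x u + x v

/-- The minimum weight of a two-cover. -/
noncomputable def lp (A : V → V → Bool) : ℕ := sInf {s | ∃ x, TwoCover A x ∧ ∑ v, x v = s}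

/-- There is a vertex cover `C` with `c + 2 |C| ≤ B`. -/
def HasVC (A : V → V → Bool) (c B : ℕ) : Prop := ∃ C, Cov A C ∧ c + 2 * #C ≤ B

variable {A : V → V → Bool}

@[simp] theorem mem_nbr {u v : V} : u ∈ nbr A v ↔ A v u = true := by simp [nbr]

@[simp] theorem mem_supp {u : V} : u ∈ supp A ↔ ∃ v, A u v = true := by simp [supp]

theorem del_eq_true {S : Finset V} {u v : V} :
    del A S u v = true ↔ A u v = true ∧ u ∉ S ∧ v ∉ S := by simp [del]

theorem Sym.del (hA : Sym A) (S : Finset V) : Sym (del A S) := by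
  intro u v
  simp only [VertexCover.del, hA u v]
  cases A v u <;> simp [Bool.and_comm]

theorem del_del (S T : Finset V) : del (del A S) T = del A (S ∪ T) := by
  ext u v
  rw [Bool.eq_iff_iff]
  simp only [del_eq_true, mem_union]
  tauto

theorem lp_le {x : V → ℕ} (h : TwoCover A x) : lp A ≤ ∑ v, x v := Nat.sInf_le ⟨x, h, rfl⟩

theorem exists_lp (A : V → V → Bool) : ∃ x, TwoCover A x ∧ ∑ v, x v = lp A :=
  Nat.sInf_mem (s := {s | ∃ x, TwoCover A x ∧ ∑ v, x v = s})
    ⟨_, fun _ => 2, fun _ _ _ => by simp, rfl⟩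

/-- Raising a solution on the remaining graph by `2` on `S` repairs all deleted edges. Hence
choosing vertices never lowers `c + lp`. -/
theorem lp_le_del (A : V → V → Bool) (S : Finset V) : lp A ≤ lp (del A S) + 2 * #S := by
  obtain ⟨x, hx, hs⟩ := exists_lp (del A S)
  have h : TwoCover A fun u => x u + if u ∈ S then 2 else 0 := by
    intro u v huv
    by_cases hu : u ∈ S
    · simp [hu]; omega
    by_cases hv : v ∈ S
    · simp [hv]; omega
    · have := hx u v (del_eq_true.2 ⟨huv, hu, hv⟩)
      simpa [hu, hv] using this
  refine (lp_le h).trans ?_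
  rw [sum_add_distrib, hs, sum_ite_mem, univ_inter, sum_const, smul_eq_mul, mul_comm]

/-- This is the weight of the all-half solution, which has value `1` after doubling. -/
theorem lp_le_card_supp (hA : Sym A) : lp A ≤ #(supp A) := by
  have h : TwoCover A fun u => if u ∈ supp A then 1 else 0 := by
    intro u v huv
    have hu : u ∈ supp A := mem_supp.2 ⟨v, huv⟩
    have hv : v ∈ supp A := mem_supp.2 ⟨u, hA u v ▸ huv⟩
    simp only [hu, hv, if_true, Nat.reduceAdd, le_refl]
  refine (lp_le h).trans ?_
  rw [sum_ite_mem, univ_inter, sum_const, smul_eq_mul, mul_one]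

theorem Cov.lp_le {C : Finset V} (h : Cov A C) : lp A ≤ 2 * #C := by
  have h' : TwoCover A fun u => if u ∈ C then 2 else 0 := by
    intro u v huv
    rcases h u v huv with hu | hu <;> simp [hu]
  refine (VertexCover.lp_le h').trans ?_
  rw [sum_ite_mem, univ_inter, sum_const, smul_eq_mul, mul_comm]

/-- This justifies dropping a subproblem whose lower bound exceeds the budget. -/
theorem HasVC.lp_le {c B : ℕ} (h : HasVC A c B) : c + lp A ≤ B := by
  obtain ⟨C, hC, hB⟩ := h
  have := hC.lp_le
  omega

theorem HasVC.of_del {S : Finset V} {c c' B : ℕ} (hc : c + 2 * #S ≤ c')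
    (h : HasVC (del A S) c' B) : HasVC A c B := by
  obtain ⟨C, hC, hB⟩ := h
  refine ⟨C ∪ S, fun u v huv => ?_, ?_⟩
  · have := hC u v
    rw [del_eq_true] at this
    simp only [mem_union]
    tauto
  · have := card_union_le C S
    omega

theorem Cov.hasVC_del {C S : Finset V} (hC : Cov A C) (hS : S ⊆ C) {c c' B : ℕ}
    (hc : c' ≤ c + 2 * #S) (hB : c + 2 * #C ≤ B) : HasVC (del A S) c' B := by
  refine ⟨C \ S, fun u v huv => ?_, ?_⟩
  · have := hC u v
    rw [del_eq_true] at huv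
    simp only [mem_sdiff]
    tauto
  · rw [card_sdiff_of_subset hS]
    have := card_le_card hS
    omega

/-- Persistency: a vertex with value `1` in an optimal half-integral solution lies in some minimum
vertex cover. -/
theorem exists_cov_mem {v : V} (hv : lp (del A {v}) + 2 ≤ lp A) {C : Finset V}
    (hC : Cov A C) : ∃ C', v ∈ C' ∧ Cov A C' ∧ #C' ≤ #C := by
  obtain ⟨y, hy, hs⟩ := exists_lp (del A {v})
  let x : V → ℕ := fun u => if u = v then 2 else y u
  have hx : TwoCover A x := by
    intro a b hab
    by_cases ha : a = v
    · simp [x, ha]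
    by_cases hb : b = v
    · simp [x, hb]
    · simpa [x, ha, hb] using hy a b (del_eq_true.2 ⟨hab, by simpa, by simpa⟩)
  have hxs : ∑ u, x u ≤ lp A := by
    refine le_trans ?_ hv
    rw [← hs]
    have : ∀ u, x u ≤ y u + if u = v then 2 else 0 := by
      intro u; by_cases hu : u = v <;> simp [x, hu]
    refine (sum_le_sum fun u _ => this u).trans ?_
    simp [sum_add_distrib]
  let O := univ.filter fun u => 2 ≤ x u
  let Z := univ.filter fun u => x u = 0
  -- Moving `x` towards `C` by lowering the twos outside `C` and raising the zeros inside keeps it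
  -- feasible because `C` is a cover. Optimality of `x` then gives `|O \ C| ≤ |Z ∩ C|`, so
  -- exchanging these sets does not enlarge the cover.
  let x' : V → ℕ := fun u => if u ∈ O \ C ∪ Z ∩ C then 1 else x u
  have hx' : TwoCover A x' := by
    intro a b hab
    have h1 := hx a b hab
    have h2 := hC a b hab
    simp only [x', O, Z, mem_union, mem_sdiff, mem_inter, mem_filter, mem_univ, true_and]
    by_cases ha : a ∈ C <;> by_cases hb : b ∈ C <;> simp only [ha, hb] at h2 ⊢ <;>
      simp only [or_false, not_true_eq_false, and_false, and_true, false_or, not_false_eq_true] <;>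
      first | (split_ifs <;> omega) | simp at h2
  have h1 := hxs.trans (lp_le hx')
  have h2 : ∀ u, x' u + (if u ∈ O \ C then 1 else 0) ≤ x u + if u ∈ Z ∩ C then 1 else 0 := by
    intro u
    simp only [x', O, Z, mem_union, mem_sdiff, mem_inter, mem_filter, mem_univ, true_and]
    by_cases hu : u ∈ C <;>
      simp only [hu, not_true_eq_false, and_false, and_true, false_or, not_false_eq_true,
        or_false, if_false] <;> split_ifs <;> omega
  have h3 := sum_le_sum fun u (_ : u ∈ univ) => h2 u
  rw [sum_add_distrib, sum_add_distrib, sum_ite_mem, sum_ite_mem, univ_inter, univ_inter,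
    sum_const, sum_const, smul_eq_mul, smul_eq_mul, mul_one, mul_one] at h3
  refine ⟨(C \ Z) ∪ O, mem_union_right _ (by simp [O, x]), ?_, ?_⟩
  · intro a b hab
    have h1 := hx a b hab
    have h2 := hC a b hab
    simp only [O, Z, mem_union, mem_sdiff, mem_filter, mem_univ, true_and]
    by_cases ha : a ∈ C <;> by_cases hb : b ∈ C <;> simp only [ha, hb] at h2 ⊢ <;>
      simp at h2 ⊢ <;> omega
  · have hsub : (C \ Z) ∪ O ⊆ (C \ (Z ∩ C)) ∪ (O \ C) := by
      intro u
      simp only [O, Z, mem_union, mem_sdiff, mem_inter, mem_filter, mem_univ, true_and]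
      by_cases hu : u ∈ C <;> simp [hu]
      omega
    have h4 := (card_le_card hsub).trans (card_union_le _ _)
    rw [card_sdiff_of_subset inter_subset_right] at h4
    have := card_le_card (inter_subset_right : Z ∩ C ⊆ C)
    omega

/-! ### Reduced graphs: the all-half solution is the unique optimum -/

/-- No loops, and no optimal solution of the linear program has a value `1`. -/
def Reduced (A : V → V → Bool) : Prop :=
  (∀ v, A v v = false) ∧ ∀ v, lp A ≤ lp (del A {v}) + 1

/-- Setting the value at `v` to zero leaves a solution after deletion of `v` and saves at least `2`,
while by hypothesis deletion lowers the optimum by at most `1`. -/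
theorem lp_lt_of_two_le (h : ∀ v, lp A ≤ lp (del A {v}) + 1) {x : V → ℕ} (hx : TwoCover A x)
    {v : V} (hv : 2 ≤ x v) : lp A < ∑ u, x u := by
  have h1 : TwoCover (del A {v}) fun u => if u = v then 0 else x u := by
    intro a b hab
    simp only [del_eq_true, mem_singleton] at hab
    simpa [hab.2.1, hab.2.2] using hx a b hab.1
  have h2 := lp_le h1
  have h3 : ∑ u, (if u = v then 0 else x u) + x v = ∑ u, x u := by
    rw [← add_sum_erase univ x (mem_univ v), ← add_sum_erase univ _ (mem_univ v)]
    simp only [if_true, zero_add]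
    rw [add_comm]
    congr 1
    exact sum_congr rfl fun u hu => by simp [(mem_erase.1 hu).1]
  have := h v
  omega

/-- An optimum has no value above `1`, so each endpoint of an edge must have value at least `1`. -/
theorem card_supp_le_lp (h : ∀ v, lp A ≤ lp (del A {v}) + 1) : #(supp A) ≤ lp A := by
  obtain ⟨x, hx, hs⟩ := exists_lp A
  have h1 : ∀ u, x u ≤ 1 := by
    intro u
    by_contra hu
    have := lp_lt_of_two_le h hx (v := u) (by omega)
    omega
  rw [← hs, card_eq_sum_ones]
  refine (sum_le_sum fun u hu => ?_).trans (sum_le_univ_sum_of_nonneg fun _ => Nat.zero_le _)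
  obtain ⟨w, hw⟩ := mem_supp.1 hu
  have := hx u w hw
  have := h1 w
  omega

/-- In a reduced graph every nonempty independent set of vertices that are not isolated has more
neighbours than elements. -/
theorem Reduced.card_lt (h : Reduced A) (hA : Sym A) {Y N : Finset V} (hY : Y.Nonempty)
    (hYs : Y ⊆ supp A) (hN : ∀ u, u ∈ N ↔ ∃ y ∈ Y, A y u = true) (hd : Disjoint Y N) :
    #Y < #N := by
  have hNs : N ⊆ supp A := fun u hu => by
    obtain ⟨y, _, hy⟩ := (hN u).1 hu
    exact mem_supp.2 ⟨y, hA y u ▸ hy⟩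
  -- Shifting from `Y` to its neighbours changes the weight of the all-half solution by `|N| - |Y|`.
  -- A value `2` occurs, so the weight must exceed the optimum.
  let x : V → ℕ := fun u => if u ∈ N then 2 else if u ∈ Y then 0 else if u ∈ supp A then 1 else 0
  have hx : TwoCover A x := by
    intro a b hab
    have ha : a ∈ supp A := mem_supp.2 ⟨b, hab⟩
    have hb : b ∈ supp A := mem_supp.2 ⟨a, hA a b ▸ hab⟩
    have h1 : a ∈ Y → b ∈ N := fun h => (hN b).2 ⟨a, h, hab⟩
    have h2 : b ∈ Y → a ∈ N := fun h => (hN a).2 ⟨b, h, hA a b ▸ hab⟩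
    simp only [x, ha, hb, if_true]
    split_ifs <;> first | omega | tauto
  obtain ⟨y, hy⟩ := hY
  obtain ⟨w, hw⟩ := mem_supp.1 (hYs hy)
  have hwN : w ∈ N := (hN w).2 ⟨y, hy, hw⟩
  have h1 := lp_lt_of_two_le h.2 hx (v := w) (by simp [x, hwN])
  have h2 := card_supp_le_lp h.2
  have h3 : ∀ u, x u + (if u ∈ Y then 1 else 0) =
      (if u ∈ N then 1 else 0) + if u ∈ supp A then 1 else 0 := by
    intro u
    have h1 : u ∈ Y → u ∉ N := fun h => disjoint_left.1 hd h
    have h2 := @hNs u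
    have h3 := @hYs u
    simp only [x]
    split_ifs <;> first | rfl | tauto
  have h4 := sum_congr rfl fun u (_ : u ∈ univ) => h3 u
  rw [sum_add_distrib, sum_add_distrib, sum_ite_mem, sum_ite_mem, sum_ite_mem, univ_inter,
    univ_inter, univ_inter, sum_const, sum_const, sum_const] at h4
  simp only [smul_eq_mul, mul_one] at h4
  omega

/-! ### Folding -/

/-- `u` is adjacent to some vertex of `W`. -/
def adjTo (A : V → V → Bool) (W : Finset V) (u : V) : Bool := decide (∃ a, a ∈ W ∧ A a u = true)

/-- Deletion of `D ⊇ W`, followed by adding (under the name `v`) a vertex that results from merging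
the vertices of `W`. -/
def fold (A : V → V → Bool) (v : V) (D W : Finset V) (a b : V) : Bool :=
  if a = v then
    if b = v then decide (∃ u, u ∈ W ∧ adjTo A W u = true) else !decide (b ∈ D) && adjTo A W b
  else if b = v then !decide (a ∈ D) && adjTo A W a else del A D a b

theorem adjTo_iff {W : Finset V} {u : V} : adjTo A W u = true ↔ ∃ a ∈ W, A a u = true := by
  simp [adjTo]

theorem Sym.fold (hA : Sym A) (v : V) (D W : Finset V) : Sym (fold A v D W) := by
  intro a b
  by_cases ha : a = v <;> by_cases hb : b = v <;> simp [VertexCover.fold, ha, hb]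
  exact hA.del D a b

/-- `Z` is a set whose neighbourhood lies in `W`, where `W` has one element more than `Z`, and all
nonempty subsets of `Z` have more neighbours than elements. -/
structure Foldable (A : V → V → Bool) (v : V) (Z W : Finset V) : Prop where
  sym : Sym A
  mem : v ∈ Z
  disj : Disjoint Z W
  nbr_mem : ∀ u ∈ Z, ∀ w, A u w = true → w ∈ W
  card : #W = #Z + 1
  card_lt : ∀ Y ⊆ Z, Y.Nonempty → ∀ N : Finset V, (∀ u, u ∈ N ↔ ∃ y ∈ Y, A y u = true) → #Y < #N

namespace Foldable

variable {v : V} {Z W : Finset V}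

/-- If `W` is not independent, the option of missing `W` is ruled out. The loop records this, and
`takeable` then forces the merged vertex into the cover. -/
theorem fold_self (u w : V) (hu : u ∈ W) (hw : w ∈ W) (h : A u w = true) :
    fold A v (Z ∪ W) W v v = true := by
  simp only [fold, if_true]
  exact decide_eq_true ⟨w, hw, adjTo_iff.2 ⟨u, hu, h⟩⟩

theorem fold_left (h : Foldable A v Z W) (u w : V) (hu : u ∈ W) (hw : w ∉ Z ∪ W)
    (huw : A u w = true) : fold A v (Z ∪ W) W v w = true := by
  have hwv : w ≠ v := fun e => hw (e ▸ mem_union_left _ h.mem)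
  simp only [fold, if_true, hwv, if_false]
  simp only [hw, decide_false, Bool.not_false, Bool.true_and]
  exact adjTo_iff.2 ⟨u, hu, huw⟩

theorem fold_other (h : Foldable A v Z W) (u w : V) (hu : u ∉ Z ∪ W) (hw : w ∉ Z ∪ W)
    (huw : A u w = true) : fold A v (Z ∪ W) W u w = true := by
  have hwv : w ≠ v := fun e => hw (e ▸ mem_union_left _ h.mem)
  have huv : u ≠ v := fun e => hu (e ▸ mem_union_left _ h.mem)
  simp only [fold, hwv, huv, if_false]
  exact del_eq_true.2 ⟨huw, hu, hw⟩

/-- The possible positions of an edge, up to symmetry. -/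
theorem edge_cases (h : Foldable A v Z W) {P : V → V → Prop} (hP : ∀ a b, P a b → P b a)
    (h1 : ∀ a b, a ∈ Z → b ∈ W → P a b)
    (h2 : ∀ a b, a ∈ W → b ∈ W → A a b = true → P a b)
    (h3 : ∀ a b, a ∈ W → b ∉ Z → b ∉ W → A a b = true → P a b)
    (h4 : ∀ a b, a ∉ Z → a ∉ W → b ∉ Z → b ∉ W → A a b = true → P a b) (a b : V)
    (hab : A a b = true) : P a b := by
  have hba : A b a = true := h.sym a b ▸ hab
  by_cases haZ : a ∈ Z
  · exact h1 a b haZ (h.nbr_mem a haZ b hab)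
  by_cases hbZ : b ∈ Z
  · exact hP _ _ (h1 b a hbZ (h.nbr_mem b hbZ a hba))
  by_cases haW : a ∈ W
  · by_cases hbW : b ∈ W
    · exact h2 a b haW hbW hab
    · exact h3 a b haW hbZ hbW hab
  by_cases hbW : b ∈ W
  · exact hP _ _ (h3 b a hbW haZ haW hba)
  exact h4 a b haZ haW hbZ hbW hab

/-- A solution is unfolded by giving `W` the value `a` of the merged vertex and `Z` the
complementary value `2 - a`. As `|W| = |Z| + 1`, these values add up to `2 |Z| + a`. -/
theorem lp_le (h : Foldable A v Z W) : lp A ≤ lp (fold A v (Z ∪ W) W) + 2 * #Z := by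
  obtain ⟨y, hy, hs⟩ := exists_lp (fold A v (Z ∪ W) W)
  -- The cap makes `2 - a` a true complement; values above `2` are never needed.
  let a := min 2 (y v)
  let x : V → ℕ := fun u => if u ∈ Z then 2 - a else if u ∈ W then a else y u
  have hd : ∀ u, u ∈ W → u ∉ Z := fun u hu hu' => disjoint_left.1 h.disj hu' hu
  have hx : TwoCover A x := by
    refine h.edge_cases (P := fun u w => 2 ≤ x u + x w) (fun u w h => by omega) ?_ ?_ ?_ ?_
    · intro u w hu hw
      simp only [x, hu, hw, hd w hw, if_true, if_false]; omega
    · intro u w hu hw huw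
      have := hy v v (fold_self u w hu hw huw)
      simp only [x, hu, hw, hd w hw, hd u hu, if_true, if_false]; omega
    · intro u w hu hwZ hwW huw
      have := hy v w (h.fold_left u w hu (by simp [hwZ, hwW]) huw)
      simp only [x, hu, hwZ, hwW, hd u hu, if_true, if_false]; omega
    · intro u w huZ huW hwZ hwW huw
      have := hy u w (h.fold_other u w (by simp [huZ, huW]) (by simp [hwZ, hwW]) huw)
      simp only [x, huZ, huW, hwZ, hwW, if_false]; omega
  refine (VertexCover.lp_le hx).trans ?_
  have h1 : ∀ u, x u + (if u = v then a else 0) ≤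
      y u + ((if u ∈ Z then 2 - a else 0) + if u ∈ W then a else 0) := by
    intro u
    by_cases huv : u = v
    · subst huv; simp [x, h.mem]; omega
    · have := hd u
      simp only [x, huv, if_false]
      split_ifs <;> omega
  have h2 := sum_le_sum fun u (_ : u ∈ univ) => h1 u
  simp only [sum_add_distrib, sum_ite_mem, univ_inter, sum_const, smul_eq_mul, h.card, hs,
    sum_ite_eq', mem_univ, if_true] at h2
  have h3 : #Z * (2 - a) + (#Z + 1) * a = 2 * #Z + a := by
    obtain ⟨b, hb⟩ : ∃ b, 2 = a + b := ⟨2 - a, by omega⟩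
    rw [hb, Nat.add_sub_cancel_left]; ring
  omega

/-- The merged vertex stands for the choice of `W` over `Z`: if it is in the cover it expands to
`W`, otherwise `Z` is added. In either case the expansion adds at most `|Z|` vertices. -/
theorem hasVC_iff (h : Foldable A v Z W) (c B : ℕ) :
    HasVC A c B ↔ HasVC (fold A v (Z ∪ W) W) (c + 2 * #Z) B := by
  have hd : ∀ u, u ∈ W → u ∉ Z := fun u hu hu' => disjoint_left.1 h.disj hu' hu
  constructor
  · rintro ⟨C, hC, hB⟩
    by_cases hc : Z ⊆ C ∧ Disjoint W C
    · refine ⟨C \ Z, fun a b hab => ?_, ?_⟩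
      · have hW : ∀ u ∈ W, ∀ w, A u w = true → w ∈ C := fun u hu w huw =>
          (hC u w huw).resolve_left (disjoint_left.1 hc.2 hu)
        simp only [fold] at hab
        split_ifs at hab with h1 h2 h2
        · simp only [decide_eq_true_eq] at hab
          obtain ⟨u, hu, hu'⟩ := hab
          obtain ⟨w, hw, hwu⟩ := adjTo_iff.1 hu'
          exact absurd (hW w hw u hwu) (disjoint_left.1 hc.2 hu)
        · simp only [Bool.and_eq_true, Bool.not_eq_true', decide_eq_false_iff_not, mem_union,
            not_or] at hab
          obtain ⟨w, hw, hwu⟩ := adjTo_iff.1 hab.2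
          exact Or.inr (mem_sdiff.2 ⟨hW w hw b hwu, hab.1.1⟩)
        · simp only [Bool.and_eq_true, Bool.not_eq_true', decide_eq_false_iff_not, mem_union,
            not_or] at hab
          obtain ⟨w, hw, hwu⟩ := adjTo_iff.1 hab.2
          exact Or.inl (mem_sdiff.2 ⟨hW w hw a hwu, hab.1.1⟩)
        · simp only [del_eq_true, mem_union, not_or] at hab
          have := hC a b hab.1
          simp only [mem_sdiff]
          tauto
      · rw [card_sdiff_of_subset hc.1]
        have := card_le_card hc.1
        omega
    -- In the remaining case `Z ∩ C` can be traded for `W \ C`. If `C` misses part of `Z`, the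
    -- neighbours of that part lie in `W ∩ C` and outnumber it; if `Z ⊆ C`, then `C` meets `W`,
    -- which makes up for the one extra element of `W`.
    · have hle : #(W \ C) ≤ #(Z ∩ C) := by
        have e1 := card_sdiff_add_card_inter W C
        have e2 := card_sdiff_add_card_inter Z C
        have e3 := h.card
        by_cases hY : (Z \ C).Nonempty
        · have h1 := h.card_lt (Z \ C) sdiff_subset hY
            (univ.filter fun u => ∃ y ∈ Z \ C, A y u = true) (by simp)
          have h2 : (univ.filter fun u => ∃ y ∈ Z \ C, A y u = true) ⊆ W ∩ C := by
            intro u hu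
            simp only [mem_filter, mem_univ, true_and, mem_sdiff] at hu
            obtain ⟨y, hy, hyu⟩ := hu
            exact mem_inter.2 ⟨h.nbr_mem y hy.1 u hyu, (hC y u hyu).resolve_left hy.2⟩
          have := card_le_card h2
          omega
        · rw [not_nonempty_iff_eq_empty] at hY
          have h1 : ¬ Disjoint W C := fun h => hc ⟨sdiff_eq_empty_iff_subset.1 hY, h⟩
          have h2 : 0 < #(W ∩ C) := card_pos.2 (not_disjoint_iff_nonempty_inter.1 h1)
          rw [hY, card_empty] at e2
          omega
      refine ⟨insert v ((C \ (Z ∩ C)) \ W), fun a b hab => ?_, ?_⟩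
      · simp only [fold] at hab
        split_ifs at hab with h1 h2 h2
        · exact Or.inl (by simp [h1])
        · exact Or.inl (by simp [h1])
        · exact Or.inr (by simp [h2])
        · simp only [del_eq_true, mem_union, not_or] at hab
          have := hC a b hab.1
          simp only [mem_insert, mem_sdiff, mem_inter]
          tauto
      · have h1 := card_insert_le v ((C \ (Z ∩ C)) \ W)
        have h2 : #((C \ (Z ∩ C)) \ W) + #W = #(C \ (Z ∩ C)) + #(W \ C) := by
          have h3 := card_union_add_card_inter (C \ (Z ∩ C)) W
          have h4 := card_sdiff_add_card (C \ (Z ∩ C)) W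
          have h5 : W \ (C \ (Z ∩ C)) = W \ C := by
            ext u; have := hd u; simp only [mem_sdiff, mem_inter]; tauto
          have h6 := card_sdiff_add_card W (C \ (Z ∩ C))
          rw [h5, union_comm] at h6
          omega
        have h3 := card_sdiff_of_subset (inter_subset_right : Z ∩ C ⊆ C)
        have h4 := card_le_card (inter_subset_right : Z ∩ C ⊆ C)
        have := h.card
        omega
  · rintro ⟨C, hC, hB⟩
    have hvZ := h.mem
    by_cases hv : v ∈ C
    · refine ⟨C.erase v ∪ W, ?_, ?_⟩
      · refine h.edge_cases (P := fun a b => a ∈ C.erase v ∪ W ∨ b ∈ C.erase v ∪ W)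
          (fun a b => Or.symm) ?_ ?_ ?_ ?_
        · exact fun a b _ hb => Or.inr (mem_union_right _ hb)
        · exact fun a b _ hb _ => Or.inr (mem_union_right _ hb)
        · exact fun a b ha _ _ _ => Or.inl (mem_union_right _ ha)
        · intro a b haZ haW hbZ hbW hab
          have := hC a b (h.fold_other a b (by simp [haZ, haW]) (by simp [hbZ, hbW]) hab)
          have h1 : a ≠ v := fun e => haZ (e ▸ hvZ)
          have h2 : b ≠ v := fun e => hbZ (e ▸ hvZ)
          simp only [mem_union, mem_erase]
          tauto
      · have h1 := card_union_le (C.erase v) W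
        have h2 := card_erase_add_one hv
        have := h.card
        omega
    · refine ⟨C ∪ Z, ?_, ?_⟩
      · refine h.edge_cases (P := fun a b => a ∈ C ∪ Z ∨ b ∈ C ∪ Z) (fun a b => Or.symm) ?_ ?_ ?_ ?_
        · exact fun a b ha _ => Or.inl (mem_union_right _ ha)
        · intro a b ha hb hab
          have := hC v v (fold_self a b ha hb hab)
          tauto
        · intro a b ha hbZ hbW hab
          have := hC v b (h.fold_left a b ha (by simp [hbZ, hbW]) hab)
          exact Or.inr (mem_union_left _ (this.resolve_left hv))
        · intro a b haZ haW hbZ hbW hab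
          have := hC a b (h.fold_other a b (by simp [haZ, haW]) (by simp [hbZ, hbW]) hab)
          simp only [mem_union]
          tauto
      · have := card_union_le C Z
        omega

/-- A neighbour of `v` lies in `W` and becomes isolated, while the merged vertex reuses the name of
a vertex that was not isolated. -/
theorem supp_fold_ssubset (h : Foldable A v Z W) (hZ : Z ⊆ supp A) :
    supp (fold A v (Z ∪ W) W) ⊂ supp A := by
  obtain ⟨w, hw⟩ := mem_supp.1 (hZ h.mem)
  have hwW := h.nbr_mem v h.mem w hw
  have hwv : w ≠ v := fun e => disjoint_left.1 h.disj h.mem (e ▸ hwW)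
  rw [ssubset_iff_of_subset]
  · refine ⟨w, mem_supp.2 ⟨v, h.sym v w ▸ hw⟩, fun hmem => ?_⟩
    obtain ⟨b, hb⟩ := mem_supp.1 hmem
    simp only [fold, hwv, if_false] at hb
    split_ifs at hb <;> simp [hwW, del] at hb
  · intro a ha
    obtain ⟨b, hb⟩ := mem_supp.1 ha
    simp only [fold] at hb
    split_ifs at hb with h1 h2 h2
    · exact h1 ▸ hZ h.mem
    · exact h1 ▸ hZ h.mem
    · simp only [Bool.and_eq_true] at hb
      obtain ⟨u, hu, hua⟩ := adjTo_iff.1 hb.2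
      exact mem_supp.2 ⟨u, h.sym u a ▸ hua⟩
    · exact mem_supp.2 ⟨b, (del_eq_true.1 hb).1⟩

end Foldable

/-! ### Finding a set to fold -/

/-- Greedy completion: add `u` if this lowers the value of the linear program by `2`. -/
noncomputable def greedyStep (A : V → V → Bool) (u : V) (S : Finset V) : Finset V :=
  if decide (lp (del A (insert u S)) + 2 ≤ lp (del A S)) then insert u S else S

theorem subset_greedyStep (u : V) (S : Finset V) : S ⊆ greedyStep A u S := by
  rw [greedyStep]; split_ifs
  · exact subset_insert u S
  · exact Subset.rfl

theorem subset_greedy (l : List V) (S : Finset V) : S ⊆ l.foldr (greedyStep A) S := by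
  induction l with
  | nil => exact Subset.rfl
  | cons u l ih => exact ih.trans (subset_greedyStep u _)

/-- Each added vertex costs `2` and lowers the linear program by at least `2`. -/
theorem lp_greedy_le (l : List V) (S : Finset V) :
    lp (del A (l.foldr (greedyStep A) S)) + 2 * #(l.foldr (greedyStep A) S) ≤
      lp (del A S) + 2 * #S := by
  induction l with
  | nil => exact le_rfl
  | cons u l ih =>
    refine le_trans ?_ ih
    rw [List.foldr_cons]
    generalize l.foldr (greedyStep A) S = T
    rw [greedyStep]
    split_ifs with h
    · have := card_insert_le u T
      have := of_decide_eq_true h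
      omega
    · exact le_rfl

/-- One pass suffices because a rejected vertex stays rejected: adding `a` lowers `lp` by at least
`2` on the current graph, and by at most `2` after deletion of `u`, so the gain from `u` cannot
grow. -/
theorem lp_greedy_insert (l : List V) (S : Finset V) :
    ∀ u ∈ l, lp (del A (l.foldr (greedyStep A) S)) ≤
      lp (del A (insert u (l.foldr (greedyStep A) S))) + 1 := by
  induction l with
  | nil => simp
  | cons a l ih =>
    intro u hu
    rw [List.foldr_cons]
    generalize l.foldr (greedyStep A) S = T at ih
    by_cases hc : lp (del A (insert a T)) + 2 ≤ lp (del A T)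
    · have hT : greedyStep A a T = insert a T := by rw [greedyStep, if_pos (decide_eq_true hc)]
      rw [hT]
      rcases List.mem_cons.1 hu with rfl | hu
      · rw [insert_idem]; omega
      · have h1 := ih u hu
        have h2 := lp_le_del (del A (insert u T)) {a}
        rw [del_del, card_singleton] at h2
        have h3 : insert u T ∪ {a} = insert u (insert a T) := by
          ext; simp only [mem_union, mem_insert, mem_singleton]; tauto
        rw [h3] at h2
        omega
    · have hT : greedyStep A a T = T := by rw [greedyStep, if_neg (by simpa using hc)]
      rw [hT]
      rcases List.mem_cons.1 hu with rfl | hu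
      · omega
      · exact ih u hu

/-- Once its neighbours are deleted, `v` is isolated and its deletion has no effect on `lp`. -/
theorem notMem_greedy (hA : Sym A) {v : V} {S : Finset V} (hv : v ∉ S)
    (hN : ∀ w, A v w = true → w ∈ S) (l : List V) : v ∉ l.foldr (greedyStep A) S := by
  induction l with
  | nil => exact hv
  | cons a l ih =>
    rw [List.foldr_cons]
    have hS := subset_greedy (A := A) l S
    generalize l.foldr (greedyStep A) S = T at ih hS
    rw [greedyStep]
    split_ifs with h
    · rw [mem_insert]
      rintro (rfl | h')
      · have h := of_decide_eq_true h
        have : del A (insert v T) = del A T := by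
          ext x y
          rw [Bool.eq_iff_iff]
          simp only [del_eq_true, mem_insert, not_or]
          constructor
          · tauto
          · rintro ⟨hxy, hx, hy⟩
            refine ⟨hxy, ⟨?_, hx⟩, ?_, hy⟩
            · rintro rfl; exact hy (hS (hN y hxy))
            · rintro rfl; exact hx (hS (hN x (hA x y ▸ hxy)))
        rw [this] at h
        omega
      · exact ih h'
    · exact ih

/-- The vertices that become isolated when `E` is deleted. -/
def isolatedBy (A : V → V → Bool) (E : Finset V) : Finset V :=
  univ.filter fun u => u ∈ supp A ∧ u ∉ E ∧ ∀ w, A u w = true → w ∈ E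

theorem mem_isolatedBy {E : Finset V} {u : V} :
    u ∈ isolatedBy A E ↔ u ∈ supp A ∧ u ∉ E ∧ ∀ w, A u w = true → w ∈ E := by
  simp [isolatedBy]

/-- After the greedy completion to `E`, the remaining linear program is at least the number of
remaining non-isolated vertices. Comparing this with `lp A ≤ |supp A|` and the assumed slack of `1`
gives `|E| ≤ |Z| + 1` for the set `Z` isolated by `E`; strict expansion of `Z` gives the other
inequality. -/
theorem Reduced.foldable (h : Reduced A) (hA : Sym A) {v : V} {l : List V} (hl : ∀ u, u ∈ l)
    (hv : v ∈ supp A) (hle : lp (del A (nbr A v)) + 2 * #(nbr A v) ≤ lp A + 1) :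
    Foldable A v (isolatedBy A (l.foldr (greedyStep A) (nbr A v)))
      (l.foldr (greedyStep A) (nbr A v)) := by
  have h1 := lp_greedy_le (A := A) l (nbr A v)
  have h2 := lp_greedy_insert (A := A) l (nbr A v)
  have h3 := subset_greedy (A := A) l (nbr A v)
  have h4 : v ∉ l.foldr (greedyStep A) (nbr A v) :=
    notMem_greedy hA (by simp [h.1 v]) (by simp) l
  generalize l.foldr (greedyStep A) (nbr A v) = E at h1 h2 h3 h4
  have hZ := fun u => mem_isolatedBy (A := A) (E := E) (u := u)
  have hvZ : v ∈ isolatedBy A E := (hZ v).2 ⟨hv, h4, fun w hw => h3 (mem_nbr.2 hw)⟩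
  have hlt : ∀ Y ⊆ isolatedBy A E, Y.Nonempty → ∀ N : Finset V,
      (∀ u, u ∈ N ↔ ∃ y ∈ Y, A y u = true) → #Y < #N := by
    intro Y hY hne N hN
    refine h.card_lt hA hne (fun u hu => ((hZ u).1 (hY hu)).1) hN ?_
    refine disjoint_left.2 fun u hu hu' => ?_
    obtain ⟨y, hy, hyu⟩ := (hN u).1 hu'
    exact ((hZ u).1 (hY hu)).2.1 (((hZ y).1 (hY hy)).2.2 u hyu)
  refine ⟨hA, hvZ, disjoint_left.2 fun u hu => ((hZ u).1 hu).2.1,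
    fun u hu => ((hZ u).1 hu).2.2, le_antisymm ?_ ?_, hlt⟩
  · have h5 : #(supp (del A E)) ≤ lp (del A E) := by
      refine card_supp_le_lp fun u => ?_
      rw [del_del, union_comm, ← insert_eq]
      exact h2 u (hl u)
    have h6 : supp A ⊆ supp (del A E) ∪ (isolatedBy A E ∪ E) := by
      intro u hu
      simp only [mem_union, hZ]
      by_contra hcon
      push Not at hcon
      obtain ⟨w, hw, hwE⟩ := hcon.2.1 hu hcon.2.2
      exact hcon.1 (mem_supp.2 ⟨w, del_eq_true.2 ⟨hw, hcon.2.2, hwE⟩⟩)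
    have h7 := (card_le_card h6).trans (card_union_le _ _)
    have h8 := card_union_le (isolatedBy A E) E
    have h9 := lp_le_card_supp hA
    omega
  · refine (hlt _ Subset.rfl ⟨v, hvZ⟩ (univ.filter fun u => ∃ y ∈ isolatedBy A E, A y u = true)
      (by simp)).trans_le (card_le_card fun u hu => ?_)
    simp only [mem_filter, mem_univ, true_and] at hu
    obtain ⟨y, hy, hyu⟩ := hu
    exact ((hZ y).1 hy).2.2 u hyu

end VertexCover

/-! ### Computing the value of the linear program by an auction -/

namespace VertexCover

open Finset TreeWhile

variable {n : ℕ} {A : Fin n → Fin n → Bool}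

/-- A state of the auction: prices, and a partial matching. -/
abbrev Auction (n : ℕ) : Type := (Fin n → ℕ) × (Fin n → Fin n → Bool)

/-- The unmatched vertex `u` may bid for its cheapest neighbour `v`. -/
def bid (A : Fin n → Fin n → Bool) (s : Auction n) (u v : Fin n) : Bool :=
  A u v && (decide (s.1 v < n + 1) && (decide (∀ w, (!s.2 u w) = true) &&
    decide (∀ w, (!A u w || decide (s.1 v ≤ s.1 w)) = true)))

/-- Give `v` to `u` and raise its price. -/
def place (s : Auction n) (u v : Fin n) : Auction n :=
  (fun w => if decide (w = v) then s.1 w + 1 else s.1 w,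
    fun a b => if decide (b = v) then decide (a = u) else s.2 a b)

/-- One step of the auction. -/
def auctionStep (A : Fin n → Fin n → Bool) (s : Auction n) : Auction n :=
  match findFin fun u => decide (∃ v, bid A s u v = true) with
  | none => s
  | some u => match findFin (bid A s u) with
    | none => s
    | some v => place s u v

theorem bid_iff {s : Auction n} {u v : Fin n} : bid A s u v = true ↔
    A u v = true ∧ s.1 v < n + 1 ∧ (∀ w, s.2 u w = false) ∧
      ∀ w, A u w = true → s.1 v ≤ s.1 w := by
  simp only [bid, Bool.and_eq_true, decide_eq_true_eq, Bool.not_eq_true', Bool.or_eq_true]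
  simp only [Bool.eq_false_iff, ne_eq, imp_iff_not_or]

theorem auctionStep_eq (A : Fin n → Fin n → Bool) (s : Auction n) :
    (∃ u v, bid A s u v = true ∧ auctionStep A s = place s u v) ∨
      ((∀ u v, bid A s u v = false) ∧ auctionStep A s = s) := by
  unfold auctionStep
  split
  · rename_i h
    refine Or.inr ⟨fun u v => ?_, rfl⟩
    have := findFin_none h u
    rw [decide_eq_false_iff_not] at this
    push Not at this
    simpa using this v
  · rename_i u h
    have hu := of_decide_eq_true (findFin_some h)
    split
    · rename_i h'
      obtain ⟨v, hv⟩ := hu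
      rw [findFin_none h' v] at hv
      exact absurd hv (by simp)
    · rename_i v h'
      exact Or.inl ⟨u, v, findFin_some h', rfl⟩

/-- The invariant of the auction. -/
structure AuctionInv (A : Fin n → Fin n → Bool) (s : Auction n) : Prop where
  adj : ∀ u v, s.2 u v = true → A u v = true
  price : ∀ u v, s.2 u v = true → ∀ w, A u w = true → s.1 v ≤ s.1 w + 1
  left : ∀ u u' v, s.2 u v = true → s.2 u' v = true → u = u'
  right : ∀ u v v', s.2 u v = true → s.2 u v' = true → v = v'
  pos : ∀ v, 0 < s.1 v ↔ ∃ u, s.2 u v = true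
  bound : ∀ v, s.1 v ≤ n + 1

/-- The initial state of the auction. -/
def auctionInit (n : ℕ) : Auction n := (fun _ => 0, fun _ _ => false)

theorem auctionInv_init : AuctionInv A (auctionInit n) := by
  constructor <;> simp [auctionInit]

/-- The new owner chose a cheapest neighbour and the price rose by one, so its price is within one
of the minimum. For other owners only competing prices rise, and a displaced owner becomes free
while `v` stays matched. -/
theorem AuctionInv.place {s : Auction n} (h : AuctionInv A s) {u v : Fin n}
    (hb : bid A s u v = true) : AuctionInv A (place s u v) := by
  obtain ⟨huv, hp, hf, hmin⟩ := bid_iff.1 hb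
  have hM : ∀ a b, (VertexCover.place s u v).2 a b = true ↔
      (b = v ∧ a = u) ∨ (b ≠ v ∧ s.2 a b = true) := by
    intro a b; by_cases hb : b = v <;> simp [VertexCover.place, hb]
  have hP : ∀ w, s.1 w ≤ (VertexCover.place s u v).1 w := by
    intro w; by_cases hb : w = v <;> simp [VertexCover.place, hb]
  have hPv : (VertexCover.place s u v).1 v = s.1 v + 1 := by simp [VertexCover.place]
  have hPn : ∀ w, w ≠ v → (VertexCover.place s u v).1 w = s.1 w := by
    intro w hw; simp [VertexCover.place, hw]
  have hnu : ∀ b, s.2 u b ≠ true := fun b => by simp [hf b]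
  constructor
  · intro a b hab
    rcases (hM a b).1 hab with ⟨rfl, rfl⟩ | ⟨_, h'⟩
    · exact huv
    · exact h.adj _ _ h'
  · intro a b hab w hw
    rcases (hM a b).1 hab with ⟨rfl, rfl⟩ | ⟨hb, h'⟩
    · rw [hPv]
      have := hmin w hw
      have := hP w
      omega
    · rw [hPn b hb]
      have := h.price a b h' w hw
      have := hP w
      omega
  · intro a a' b hab hab'
    rcases (hM a b).1 hab with ⟨h1, h2⟩ | ⟨hb, h'⟩ <;>
      rcases (hM a' b).1 hab' with ⟨h3, h4⟩ | ⟨hb', h''⟩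
    · rw [h2, h4]
    · exact absurd h1 hb'
    · exact absurd h3 hb
    · exact h.left _ _ _ h' h''
  · intro a b b' hab hab'
    rcases (hM a b).1 hab with ⟨h1, h2⟩ | ⟨hb, h'⟩ <;>
      rcases (hM a b').1 hab' with ⟨h3, h4⟩ | ⟨hb', h''⟩
    · rw [h1, h3]
    · exact absurd h'' (h2 ▸ hnu b')
    · exact absurd h' (h4 ▸ hnu b)
    · exact h.right _ _ _ h' h''
  · intro w
    by_cases hw : w = v
    · subst hw
      rw [hPv]
      exact ⟨fun _ => ⟨u, (hM u w).2 (Or.inl ⟨rfl, rfl⟩)⟩, fun _ => Nat.succ_pos _⟩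
    · rw [hPn w hw, h.pos w]
      exact exists_congr fun a => by rw [hM]; simp [hw]
  · intro w
    by_cases hw : w = v
    · subst hw; rw [hPv]; omega
    · rw [hPn w hw]; exact h.bound w

theorem AuctionInv.step {s : Auction n} (h : AuctionInv A s) : AuctionInv A (auctionStep A s) := by
  rcases auctionStep_eq A s with ⟨u, v, hb, he⟩ | ⟨_, he⟩ <;> rw [he]
  · exact h.place hb
  · exact h

theorem auctionInv_iterate (k : ℕ) : AuctionInv A ((auctionStep A)^[k] (auctionInit n)) := by
  induction k with
  | zero => exact auctionInv_init
  | succ k ih => rw [Function.iterate_succ_apply']; exact ih.step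

/-- Every bid raises the sum of prices by one, and a state without bids is a fixed point. -/
theorem auction_progress (k : ℕ) :
    k ≤ ∑ v, ((auctionStep A)^[k] (auctionInit n)).1 v ∨
      ∀ u v, bid A ((auctionStep A)^[k] (auctionInit n)) u v = false := by
  induction k with
  | zero => exact Or.inl (Nat.zero_le _)
  | succ k ih =>
    rw [Function.iterate_succ_apply']
    generalize (auctionStep A)^[k] (auctionInit n) = s at ih
    rcases auctionStep_eq A s with ⟨u, v, hb, he⟩ | ⟨hn, he⟩
    · left
      rcases ih with ih | ih
      · rw [he]
        have : ∑ w, (place s u v).1 w = ∑ w, (s.1 w + if w = v then 1 else 0) :=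
          sum_congr rfl fun w _ => by by_cases hw : w = v <;> simp [place, hw]
        rw [this, sum_add_distrib, sum_ite_eq' univ v]
        simpa using ih
      · rw [ih u v] at hb
        exact absurd hb (by simp)
    · right; rw [he]; exact hn

/-- The final state of the auction. -/
def auction (A : Fin n → Fin n → Bool) : Auction n :=
  (auctionStep A)^[n * (n + 1) + 1] (auctionInit n)

theorem auction_done (u v : Fin n) : bid A (auction A) u v = false := by
  rcases auction_progress (A := A) (n * (n + 1) + 1) with h | h
  -- Prices are at most `n + 1`, so their sum cannot reach the number `n * (n + 1) + 1` of
  -- iterations.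
  · have h1 := sum_le_card_nsmul univ (fun v => (auction A).1 v) (n + 1)
      fun v _ => (auctionInv_iterate (A := A) (n * (n + 1) + 1)).bound v
    rw [card_univ, Fintype.card_fin, smul_eq_mul] at h1
    exact absurd (h.trans h1) (by omega)
  · exact h u v

/-- Weak duality. -/
theorem AuctionInv.card_le {s : Auction n} (h : AuctionInv A s) {x : Fin n → ℝ}
    (h0 : ∀ v, 0 ≤ x v) (hx : ∀ u v, A u v = true → 2 ≤ x u + x v) :
    (#(univ.filter fun v => 0 < s.1 v) : ℝ) ≤ ∑ v, x v := by
  have hex : ∀ v, ∃ u, 0 < s.1 v → s.2 u v = true := by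
    intro v
    by_cases hv : 0 < s.1 v
    · obtain ⟨u, hu⟩ := (h.pos v).1 hv; exact ⟨u, fun _ => hu⟩
    · exact ⟨v, fun h => absurd h hv⟩
  choose m hm using hex
  let P := univ.filter fun v => 0 < s.1 v
  have hP : ∀ v ∈ P, s.2 (m v) v = true := fun v hv => hm v (mem_filter.1 hv).2
  have h1 : ∑ v ∈ P, (2 : ℝ) ≤ ∑ v ∈ P, (x (m v) + x v) :=
    sum_le_sum fun v hv => hx _ _ (h.adj _ _ (hP v hv))
  rw [sum_add_distrib, sum_const, nsmul_eq_mul] at h1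
  have h2 : ∑ v ∈ P, x v ≤ ∑ v, x v := sum_le_univ_sum_of_nonneg h0
  -- Distinct right vertices have distinct partners, so the left ends also count every vertex at
  -- most once.
  have h3 : ∑ v ∈ P, x (m v) ≤ ∑ v, x v := by
    rw [← sum_image (g := m) (f := x)]
    · exact sum_le_univ_sum_of_nonneg h0
    · intro a ha b hb hab
      exact h.right (m a) a b (hP a ha) (by rw [hab]; exact hP b hb)
  change ((#P : ℕ) : ℝ) ≤ _
  linarith

/-- A price level that is not attained separates cheap vertices from expensive ones. The neighbours
of cheap vertices on the left and the expensive vertices on the right cover the double cover of the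
graph, and they are no more numerous than the matched vertices. -/
theorem AuctionInv.lp_le {s : Auction n} (h : AuctionInv A s) (hA : Sym A)
    (hs : ∀ u v, bid A s u v = false) : lp A ≤ #(univ.filter fun v => 0 < s.1 v) := by
  -- There are `n + 1` levels and only `n` prices.
  obtain ⟨l, hl1, hl⟩ : ∃ l ∈ Icc 1 (n + 1), l ∉ univ.image s.1 := by
    refine exists_mem_notMem_of_card_lt_card ?_
    refine (card_image_le).trans_lt ?_
    simp
  have hl : ∀ v, s.1 v ≠ l := fun v hv => hl (mem_image.2 ⟨v, mem_univ v, hv⟩)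
  rw [mem_Icc] at hl1
  let X := univ.filter fun u => ∃ v, A u v = true ∧ s.1 v < l
  let Y := univ.filter fun v => l < s.1 v
  let Q := univ.filter fun v => 0 < s.1 v ∧ s.1 v < l
  have hcov : TwoCover A fun u => (if u ∈ X then 1 else 0) + if u ∈ Y then 1 else 0 := by
    have key : ∀ u v, A u v = true → u ∈ X ∨ v ∈ Y := by
      intro u v huv
      rcases lt_or_gt_of_ne (hl v) with h | h
      · exact Or.inl (mem_filter.2 ⟨mem_univ u, v, huv, h⟩)
      · exact Or.inr (mem_filter.2 ⟨mem_univ v, h⟩)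
    intro u v huv
    have h1 := key u v huv
    have h2 := key v u (hA u v ▸ huv)
    dsimp only
    split_ifs <;> first | omega | tauto
  -- A free `u` with a neighbour below level `l ≤ n + 1` could still bid. A matched one pays at most
  -- one more than that neighbour's price, hence at most `l`, and `l` itself is not a price.
  have hm : ∀ u ∈ X, ∃ v, s.2 u v = true ∧ s.1 v < l := by
    intro u hu
    obtain ⟨v, huv, hv⟩ := (mem_filter.1 hu).2
    by_cases hfree : ∀ w, s.2 u w = false
    · obtain ⟨v', hv', hmin⟩ := exists_min_image (nbr A u) s.1 ⟨v, mem_nbr.2 huv⟩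
      have hb : bid A s u v' = true := bid_iff.2 ⟨mem_nbr.1 hv', by
        have := hmin v (mem_nbr.2 huv); omega, hfree, fun w hw => hmin w (mem_nbr.2 hw)⟩
      rw [hs u v'] at hb
      exact absurd hb (by simp)
    · push Not at hfree
      obtain ⟨w, hw⟩ := hfree
      have hw : s.2 u w = true := by simpa using hw
      have h1 := h.price u w hw v huv
      have := hl w
      exact ⟨w, hw, by omega⟩
  choose! m hm using hm
  have hXQ : #X ≤ #Q := by
    refine card_le_card_of_injOn m (fun u hu => ?_) fun u hu u' hu' he => ?_
    · exact mem_coe.2 (mem_filter.2 ⟨mem_univ _, (h.pos _).2 ⟨u, (hm u hu).1⟩, (hm u hu).2⟩)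
    · exact h.left u u' (m u) (hm u hu).1 (by rw [he]; exact (hm u' hu').1)
  have hYQ : #Q + #Y = #(univ.filter fun v => 0 < s.1 v) := by
    rw [← card_union_of_disjoint]
    · congr 1
      ext v
      have := hl v
      simp only [Q, Y, mem_union, mem_filter, mem_univ, true_and]
      omega
    · refine disjoint_left.2 fun v hv hv' => ?_
      have h1 := (mem_filter.1 hv).2.2
      have h2 := (mem_filter.1 hv').2
      omega
  refine (VertexCover.lp_le hcov).trans ?_
  simp only [sum_add_distrib, sum_ite_mem, univ_inter, sum_const, smul_eq_mul, mul_one]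
  omega

theorem card_auction (hA : Sym A) : #(univ.filter fun v => 0 < (auction A).1 v) = lp A := by
  have hinv := auctionInv_iterate (A := A) (n * (n + 1) + 1)
  refine le_antisymm ?_ (hinv.lp_le hA auction_done)
  obtain ⟨x, hx, hs⟩ := exists_lp A
  have := hinv.card_le (x := fun v => (x v : ℝ)) (fun v => Nat.cast_nonneg _)
    fun u v huv => by exact_mod_cast hx u v huv
  rw [← hs]
  exact_mod_cast this

end VertexCover

/-! ### A program for the auction -/

namespace TreeWhile.PT

open VertexCover Polynomial

variable {ι : Type} {n W : ι → ℕ} {E : ι → Data}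

/-- Entry of a vector of numbers. -/
theorem numGet {f : ∀ i, Fin (n i) → ℕ} {j : ∀ i, Fin (n i)}
    (hf : PT n W E fun i => vec fun v => num (f i v)) (hj : PT n W E fun i => num (j i)) :
    PT n W E fun i => num (f i (j i)) := get (f := fun i v => num (f i v)) hf hj

/-- Encoding of a state of the auction. -/
def encAuction {m : ℕ} (s : Auction m) : Data := Data.cons (vec fun v => num (s.1 v)) (mat s.2)

theorem auctionPrice {s : ∀ i, Auction (n i)} (h : PT n W E fun i => encAuction (s i)) :
    PT n W E fun i => vec fun v => num ((s i).1 v) := h.hd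

theorem auctionMat {s : ∀ i, Auction (n i)} (h : PT n W E fun i => encAuction (s i)) :
    PT n W E fun i => mat (s i).2 := h.tl

theorem bid {A : ∀ i, Fin (n i) → Fin (n i) → Bool} {s : ∀ i, Auction (n i)}
    {u v : ∀ i, Fin (n i)} (hb : ∀ i w, (s i).1 w ≤ n i + 1)
    (hn : PT n W E fun i => num (n i)) (hA : PT n W E fun i => mat (A i))
    (hs : PT n W E fun i => encAuction (s i)) (hu : PT n W E fun i => num (u i))
    (hv : PT n W E fun i => num (v i)) :
    PT n W E fun i => Data.ofBool (VertexCover.bid (A i) (s i) (u i) (v i)) := by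
  refine (matGet hA hu hv).and ((lt (X + 1) (fun i => by simpa using hb i _)
    (numGet hs.auctionPrice hv) hn.succ).and ((all (P := fun i w => !(s i).2 (u i) w) hn ?_).and
      (all (P := fun i w => !A i (u i) w || decide ((s i).1 (v i) ≤ (s i).1 w)) hn ?_)))
  · exact (matGet hs.auctionMat.up hu.up here).not
  · exact (matGet hA.up hu.up here).not.or
      (le (X + 1) (fun p => by simpa using hb p.1 _)
        (numGet hs.auctionPrice.up hv.up)
        (numGet hs.auctionPrice.up here))

theorem place {s : ∀ i, Auction (n i)} {u v : ∀ i, Fin (n i)}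
    (hn : PT n W E fun i => num (n i))
    (hs : PT n W E fun i => encAuction (s i)) (hu : PT n W E fun i => num (u i))
    (hv : PT n W E fun i => num (v i)) :
    PT n W E fun i => encAuction (VertexCover.place (s i) (u i) (v i)) := by
  refine (tab hn ?_).cons (matTab hn ?_)
  · have h := numGet (f := fun p : Σ i, Fin (n i) => (s p.1).1) (j := fun p => p.2)
      hs.auctionPrice.up here
    exact (ite (finEq (j := fun p : Σ i, Fin (n i) => p.2) here hv.up)
      h.succ h).congr fun p => by simp only [VertexCover.place]; split_ifs <;> rfl
  · have hs' := (hs.auctionMat.up (β := fun i => Fin (n i) × Fin (n i))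
      (a := fun p => num p.2.1)).there (a := fun p => num p.2.2)
    exact (ite (finEq (j := fun p : Σ i, Fin (n i) × Fin (n i) => p.2.2) here
      hv.up.there)
      (finEq (j := fun p : Σ i, Fin (n i) × Fin (n i) => p.2.1) here.there
        hu.up.there) (matGet hs' here.there here)).congr
        fun p => by simp only [VertexCover.place]; split_ifs <;> rfl

theorem auctionStep {A : ∀ i, Fin (n i) → Fin (n i) → Bool} {s : ∀ i, Auction (n i)}
    (hb : ∀ i w, (s i).1 w ≤ n i + 1)
    (hn : PT n W E fun i => num (n i)) (hA : PT n W E fun i => mat (A i))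
    (hs : PT n W E fun i => encAuction (s i)) :
    PT n W E fun i => encAuction (VertexCover.auctionStep (A i) (s i)) := by
  refine findCase (P := fun i u => decide (∃ v, VertexCover.bid (A i) (s i) u v = true)) hn
    (ex (ι := Σ i, Fin (n i)) (n := fun p => n p.1)
      (P := fun p v => VertexCover.bid (A p.1) (s p.1) p.2 v) hn.up ?_) ?_ ?_
  · refine bid ?_ ?_ ?_ ?_ here.there here
    exacts [fun _ => hb _, hn.pull2 _, hA.pull2 _,
      hs.pull2 _]
  · exact hs.sub.congr fun i => by simp only [VertexCover.auctionStep, i.2]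
  · refine findCase (ι := {p : Σ i, Fin (n i) // _}) (n := fun p => n p.1.1)
      (P := fun p v => VertexCover.bid (A p.1.1) (s p.1.1) p.1.2 v)
      (hn.pull1 _) ?_ ?_ ?_
    · refine bid ?_ ?_ ?_ ?_ here.there here
      exacts [fun _ => hb _, hn.pull2 _,
        hA.pull2 _, hs.pull2 _]
    · refine congr (hs.pull1 _) fun p => ?_
      simp only [VertexCover.auctionStep, p.1.2, p.2]
    · refine congr (place (hn.pull2 _) (hs.pull2 _) here.there here) fun p => ?_
      simp only [VertexCover.auctionStep, p.1.1.2, p.2]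

/-- The value of the linear program is computable in polynomial time. -/
theorem lp {A : ∀ i, Fin (n i) → Fin (n i) → Bool} (hA' : ∀ i, Sym (A i))
    (hn : PT n W E fun i => num (n i)) (hA : PT n W E fun i => mat (A i)) :
    PT n W E fun i => num (VertexCover.lp (A i)) := by
  have hmul : PT n W E fun i => num (n i * (n i + 1)) := by
    refine (down (s := fun i j => num ((n i - j) * (n i + 1))) X (fun i => by simp) hn
      (nil.congr fun i => by simp [num]) ?_).congr fun i => by simp
    refine (add (X + 1) (fun p => by simp) (hn.pull Sigma.fst).succ.there.there
      here.there).congr fun p => ?_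
    have : n p.1 - p.2 = (n p.1 - (p.2 + 1)) + 1 := by have := p.2.2; omega
    rw [this]
    congr 1
    ring
  have hrun : PT n W E fun i => encAuction (auction (A i)) := by
    refine down (K := fun i => n i * (n i + 1) + 1) (s := fun i j => encAuction
      ((VertexCover.auctionStep (A i))^[n i * (n i + 1) + 1 - j] (auctionInit (n i))))
      (X * (X + 1) + 1) (fun i => by simp) hmul.succ ?_ ?_
    · refine (PT.cons (tab (f := fun i _ => num 0) hn nil)
        (matTab (A := fun i _ _ => false) hn nil)).congr fun i => ?_
      rw [Nat.sub_self]
      rfl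
    · refine (auctionStep (ι := Σ i, Fin (n i * (n i + 1) + 1)) (n := fun p => n p.1)
        (A := fun p => A p.1) (s := fun p => (VertexCover.auctionStep (A p.1))^[n p.1 * (n p.1 + 1) + 1 - (p.2 + 1)]
          (auctionInit (n p.1))) (fun p => (auctionInv_iterate _).bound)
        hn.up.there hA.up.there here.there).congr
          fun p => ?_
      rw [← Function.iterate_succ_apply' (VertexCover.auctionStep (A p.1))]
      have := p.2.2
      congr 2; omega
  refine (count (P := fun i v => decide (0 < (auction (A i)).1 v)) hn
    (lt 0 (fun p => by simp) nil (numGet hrun.auctionPrice.up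
      here))).congr fun i => ?_
  rw [← card_auction (hA' i)]
  congr 2
  ext; simp

end TreeWhile.PT

/-! ### The branching algorithm -/

namespace VertexCover

open Finset TreeWhile

variable {n : ℕ} {A : Fin n → Fin n → Bool}

/-- A subproblem: a graph, and twice the number of vertices chosen so far. -/
abbrev Item (n : ℕ) : Type := (Fin n → Fin n → Bool) × ℕ

/-- `v` can be put into the cover. -/
noncomputable def takeable (A : Fin n → Fin n → Bool) (v : Fin n) : Bool :=
  A v v || decide (lp (del A {v}) + 2 ≤ lp A)

/-- Branching on `v` is efficient. -/
noncomputable def branchable (A : Fin n → Fin n → Bool) (v : Fin n) : Bool :=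
  decide (v ∈ supp A) && decide (lp A + 2 ≤ lp (del A (nbr A v)) + 2 * #(nbr A v))

/-- Greedy completion of a set, in one pass over all vertices. -/
noncomputable def greedy (A : Fin n → Fin n → Bool) (S : Finset (Fin n)) : Finset (Fin n) :=
  (List.finRange n).foldr (greedyStep A) S

/-- The set that is merged when `v` is folded. -/
noncomputable def foldSet (A : Fin n → Fin n → Bool) (v : Fin n) : Finset (Fin n) :=
  greedy A (nbr A v)

/-- The subproblem that results from folding at `v`. -/
noncomputable def foldItem (it : Item n) (v : Fin n) : Item n :=
  (fold it.1 v (isolatedBy it.1 (foldSet it.1 v) ∪ foldSet it.1 v) (foldSet it.1 v),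
    it.2 + 2 * #(isolatedBy it.1 (foldSet it.1 v)))

/-- The subproblem that results from putting the set `S` into the cover. -/
def takeItem (it : Item n) (S : Finset (Fin n)) : Item n := (del it.1 S, it.2 + 2 * #S)

/-- The subproblems to which a subproblem is reduced; `none` if it is solved. -/
noncomputable def kids (B : ℕ) (it : Item n) : Option (List (Item n)) :=
  if decide (it.2 + lp it.1 ≤ B) then
    match findFin (takeable it.1) with
    | some v => some [takeItem it {v}]
    | none => match findFin (branchable it.1) with
      | some v => some [takeItem it {v}, takeItem it (nbr it.1 v)]
      | none => match findFin fun v => decide (v ∈ supp it.1) with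
        | some v => some [foldItem it v]
        | none => none
  else some []

/-- Potential of a subproblem, a bound for the size of its search tree. -/
noncomputable def pot (B : ℕ) (it : Item n) : ℕ :=
  (#(supp it.1) + 1) * Nat.fib (B + 2 - (it.2 + lp it.1) + 1)

theorem pot_pos (B : ℕ) (it : Item n) : 0 < pot B it :=
  Nat.mul_pos (Nat.succ_pos _) (Nat.fib_pos.2 (Nat.succ_pos _))

/-- The loss of a non-isolated vertex absorbs the `+ 1` in the first factor of the potential. -/
theorem pot_le {B m : ℕ} {it : Item n} {N : ℕ} (h1 : #(supp it.1) < N)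
    (h2 : B + 2 ≤ m + it.2 + lp it.1) : pot B it ≤ N * Nat.fib (m + 1) :=
  Nat.mul_le_mul h1 (Nat.fib_mono (by omega))

theorem card_supp_del_lt {S : Finset (Fin n)} {v : Fin n} (hv : v ∈ supp A) (hS : v ∈ S) :
    #(supp (del A S)) < #(supp A) := by
  refine card_lt_card ((ssubset_iff_of_subset ?_).2 ⟨v, hv, fun hv => ?_⟩)
  · intro u hu
    obtain ⟨w, hw⟩ := mem_supp.1 hu
    exact mem_supp.2 ⟨w, (del_eq_true.1 hw).1⟩
  · obtain ⟨w, hw⟩ := mem_supp.1 hv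
    exact (del_eq_true.1 hw).2.1 hS

theorem mem_supp_of_takeable {v : Fin n} (hA : Sym A) (h : takeable A v = true) :
    v ∈ supp A := by
  by_contra hv
  simp only [mem_supp, not_exists] at hv
  have h1 : del A {v} = A := by
    ext a b
    rw [Bool.eq_iff_iff, del_eq_true]
    refine ⟨fun h => h.1, fun hab => ⟨hab, ?_, ?_⟩⟩ <;> rw [mem_singleton] <;> rintro rfl
    · exact hv _ hab
    · exact hv _ (hA a b ▸ hab)
  simp only [takeable, h1, Bool.or_eq_true, decide_eq_true_eq] at h
  rcases h with h | h
  · exact hv _ h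
  · omega

theorem hasVC_takeable {v : Fin n} (h : takeable A v = true) (c B : ℕ) :
    HasVC A c B ↔ HasVC (del A {v}) (c + 2 * #{v}) B := by
  refine ⟨?_, HasVC.of_del le_rfl⟩
  rintro ⟨C, hC, hB⟩
  have hex : ∃ C', v ∈ C' ∧ Cov A C' ∧ #C' ≤ #C := by
    simp only [takeable, Bool.or_eq_true, decide_eq_true_eq] at h
    rcases h with h | h
    · exact ⟨C, by have := hC v v h; tauto, hC, le_rfl⟩
    · exact exists_cov_mem h hC
  obtain ⟨C', hv, hC', hle⟩ := hex
  exact hC'.hasVC_del (singleton_subset_iff.2 hv) le_rfl (by omega)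

theorem hasVC_branch (v : Fin n) (c B : ℕ) :
    HasVC A c B ↔ HasVC (del A {v}) (c + 2 * #{v}) B ∨
      HasVC (del A (nbr A v)) (c + 2 * #(nbr A v)) B := by
  refine ⟨?_, fun h => h.elim (HasVC.of_del le_rfl) (HasVC.of_del le_rfl)⟩
  rintro ⟨C, hC, hB⟩
  by_cases hv : v ∈ C
  · exact Or.inl (hC.hasVC_del (singleton_subset_iff.2 hv) le_rfl hB)
  · refine Or.inr (hC.hasVC_del (fun u hu => ?_) le_rfl hB)
    exact (hC v u (mem_nbr.1 hu)).resolve_left hv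

theorem reduced_of_takeable (h : findFin (takeable A) = none) : Reduced A := by
  have h' : ∀ v, takeable A v = false := findFin_none h
  simp only [takeable, Bool.or_eq_false_iff, decide_eq_false_iff_not] at h'
  exact ⟨fun v => (h' v).1, fun v => by have := (h' v).2; omega⟩

/-- What has to be known about the reduction of a subproblem. -/
def KidsSpec (B : ℕ) (it : Item n) : Option (List (Item n)) → Prop
  | none => HasVC it.1 it.2 B
  | some l => (∀ k ∈ l, Sym k.1) ∧ (HasVC it.1 it.2 B ↔ ∃ k ∈ l, HasVC k.1 k.2 B) ∧
      (l.map (pot B)).sum < pot B it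

/-- Every child has fewer non-isolated vertices, so its first factor is at most `#(supp it.1)`, and
the Fibonacci factors of the children add up to at most that of the parent. The spare term `Nat.fib
(m + 2 + 1)` makes the decrease strict. -/
theorem kids_spec {B : ℕ} {it : Item n} (hA : Sym it.1) : KidsSpec B it (kids B it) := by
  unfold kids
  split
  swap
  · rename_i h
    refine ⟨by simp, ⟨fun h' => absurd (decide_eq_true (h'.lp_le)) h, by simp⟩, ?_⟩
    simpa using pot_pos B it
  rename_i hB
  replace hB := of_decide_eq_true hB
  -- The offset `2` in the potential leaves room for both terms of the Fibonacci recurrence, even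
  -- when a child exceeds the budget.
  obtain ⟨m, hm⟩ : ∃ m, B + 2 - (it.2 + lp it.1) = m + 2 := ⟨B - (it.2 + lp it.1), by omega⟩
  have hpot : pot B it = #(supp it.1) * Nat.fib (m + 2 + 1) + Nat.fib (m + 2 + 1) := by
    rw [pot, hm, add_mul, one_mul]
  have hfib : Nat.fib (m + 2 + 1) = Nat.fib (m + 1) + Nat.fib (m + 1 + 1) := Nat.fib_add_two
  have hpos : 0 < Nat.fib (m + 2 + 1) := Nat.fib_pos.2 (Nat.succ_pos _)
  split
  · rename_i v hv
    replace hv := findFin_some hv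
    refine ⟨by simpa [takeItem] using hA.del {v}, ?_, ?_⟩
    · simpa [takeItem] using hasVC_takeable hv it.2 B
    · have h1 := lp_le_del it.1 {v}
      have h2 := pot_le (B := B) (m := m + 2) (it := takeItem it {v})
        (card_supp_del_lt (mem_supp_of_takeable hA hv) (mem_singleton_self v))
        (by simp only [takeItem]; omega)
      simp only [List.map_cons, List.map_nil, List.sum_cons, List.sum_nil]
      omega
  rename_i ht
  have hr := reduced_of_takeable ht
  split
  · rename_i v hv
    have hv := findFin_some hv
    simp only [branchable, Bool.and_eq_true, decide_eq_true_eq] at hv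
    refine ⟨by simpa [takeItem] using ⟨hA.del {v}, hA.del (nbr it.1 v)⟩, ?_, ?_⟩
    · simpa [takeItem] using hasVC_branch (A := it.1) v it.2 B
    · obtain ⟨w, hw⟩ := mem_supp.1 hv.1
      have hws : w ∈ supp it.1 := mem_supp.2 ⟨v, hA v w ▸ hw⟩
      have h1 := hr.2 v
      have h2 := pot_le (B := B) (m := m + 1) (it := takeItem it {v})
        (card_supp_del_lt hv.1 (mem_singleton_self v))
        (by simp only [takeItem, card_singleton]; omega)
      have h3 := pot_le (B := B) (m := m) (it := takeItem it (nbr it.1 v))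
        (card_supp_del_lt hws (mem_nbr.2 hw)) (by simp only [takeItem]; omega)
      simp only [List.map_cons, List.map_nil, List.sum_cons, List.sum_nil]
      rw [hpot, hfib, mul_add]
      rw [hfib] at hpos
      omega
  rename_i hb
  split
  · rename_i v hv
    replace hv := of_decide_eq_true (findFin_some hv)
    have hb := findFin_none hb v
    simp only [branchable, hv, decide_true, Bool.true_and, decide_eq_false_iff_not] at hb
    have hf : Foldable it.1 v (isolatedBy it.1 (foldSet it.1 v)) (foldSet it.1 v) :=
      hr.foldable hA List.mem_finRange hv (by omega)
    refine ⟨by simpa [foldItem] using hA.fold v _ _, ?_, ?_⟩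
    · simpa [foldItem] using hf.hasVC_iff it.2 B
    · have h1 := hf.lp_le
      have h2 := pot_le (B := B) (m := m + 2) (it := foldItem it v)
        (card_lt_card (hf.supp_fold_ssubset fun u hu => (mem_isolatedBy.1 hu).1))
        (by simp only [foldItem]; omega)
      simp only [List.map_cons, List.map_nil, List.sum_cons, List.sum_nil]
      omega
  · rename_i hs
    -- No edges remain, and the budget test has already ensured that the vertices chosen so far are
    -- affordable.
    refine ⟨∅, fun u w huw => ?_, by simp; omega⟩
    have := findFin_none hs u
    rw [decide_eq_false_iff_not] at this
    exact absurd (mem_supp.2 ⟨w, huw⟩) this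

/-! ### The search -/

/-- One step of the search; the state is a stack of subproblems, and a flag for success. -/
noncomputable def searchStep (B : ℕ) (s : List (Item n) × Bool) : List (Item n) × Bool :=
  match s.1 with
  | [] => s
  | it :: rest => match kids B it with
    | none => ([], true)
    | some l => (l ++ rest, s.2)

/-- The invariant of the search for a solution of the subproblem `it`. -/
def SearchInv (B : ℕ) (it : Item n) (s : List (Item n) × Bool) : Prop :=
  (∀ k ∈ s.1, Sym k.1) ∧ (HasVC it.1 it.2 B ↔ s.2 = true ∨ ∃ k ∈ s.1, HasVC k.1 k.2 B)

/-- The measure of a state of the search. -/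
noncomputable def searchMeas (B : ℕ) (s : List (Item n) × Bool) : ℕ := (s.1.map (pot B)).sum

theorem searchStep_spec {B : ℕ} {it : Item n} {s : List (Item n) × Bool}
    (h : SearchInv B it s) (hs : s.1 ≠ []) : SearchInv B it (searchStep B s) ∧
      searchMeas B (searchStep B s) < searchMeas B s := by
  obtain ⟨l, b⟩ := s
  cases l with
  | nil => exact absurd rfl hs
  | cons a rest =>
    have ha := h.1 a (by simp)
    have hk := kids_spec (B := B) ha
    simp only [searchStep]
    have hp := pot_pos B a
    have h2 := h.2
    simp only [List.mem_cons, exists_eq_or_imp] at h2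
    cases hka : kids B a with
    | none =>
      rw [hka] at hk
      refine ⟨⟨by simp, ?_⟩, ?_⟩
      · simp only [h2]
        have : HasVC a.1 a.2 B := hk
        simp [this]
      · simp only [searchMeas, List.map_nil, List.sum_nil, List.map_cons, List.sum_cons]
        omega
    | some l =>
      rw [hka] at hk
      obtain ⟨h3, h4, h5⟩ := hk
      refine ⟨⟨?_, ?_⟩, ?_⟩
      · intro k hk
        rcases List.mem_append.1 hk with hk | hk
        · exact h3 k hk
        · exact h.1 k (List.mem_cons_of_mem _ hk)
      · simp only [h2, h4, List.mem_append, or_and_right, exists_or]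
      · simp only [searchMeas, List.map_append, List.sum_append, List.map_cons, List.sum_cons]
        omega

/-- The decision problem, as a bit. -/
noncomputable def hasVC (A : Fin n → Fin n → Bool) (c B : ℕ) : Bool :=
  open Classical in decide (HasVC A c B)

theorem hasVC_iff {c B : ℕ} : hasVC A c B = true ↔ HasVC A c B := by simp [hasVC]

/-! ### Finding a minimum vertex cover -/

theorem exists_hasVC (A : Fin n → Fin n → Bool) : HasVC A 0 (2 * n) :=
  ⟨univ, fun _ _ _ => by simp, by simp⟩

/-- The size of a minimum vertex cover. -/
noncomputable def coverNum (A : Fin n → Fin n → Bool) : ℕ := sInf {k | HasVC A 0 (2 * k)}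

theorem hasVC_coverNum (A : Fin n → Fin n → Bool) : HasVC A 0 (2 * coverNum A) :=
  Nat.sInf_mem (s := {k | HasVC A 0 (2 * k)}) ⟨n, exists_hasVC A⟩

theorem coverNum_le {k : ℕ} (h : HasVC A 0 (2 * k)) : coverNum A ≤ k := Nat.sInf_le h

theorem coverNum_le_card (A : Fin n → Fin n → Bool) : coverNum A ≤ n :=
  coverNum_le (exists_hasVC A)

theorem hasVC_iff_coverNum_le {k : ℕ} : HasVC A 0 (2 * k) ↔ coverNum A ≤ k := by
  refine ⟨coverNum_le, fun h => ?_⟩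
  obtain ⟨C, hC, hB⟩ := hasVC_coverNum A
  exact ⟨C, hC, by omega⟩

/-- Extending a partial solution by one vertex, if possible. -/
noncomputable def extend (A : Fin n → Fin n → Bool) (v : Fin n) (S : Finset (Fin n)) :
    Finset (Fin n) :=
  if hasVC (del A (insert v S)) (2 * (#S + 1)) (2 * coverNum A) then insert v S else S

/-- The minimum vertex cover which is found by self-reduction. -/
noncomputable def minCover (A : Fin n → Fin n → Bool) : Finset (Fin n) :=
  (List.finRange n).foldr (extend A) ∅

/-- The partial solution can always be completed within the optimum. A rejection is permanent: a
completion after adding both `a` and `v` would also have been one after adding `v` alone. -/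
theorem extend_foldr_spec (l : List (Fin n)) :
    HasVC (del A (l.foldr (extend A) ∅)) (2 * #(l.foldr (extend A) ∅)) (2 * coverNum A) ∧
      ∀ v ∈ l, v ∈ l.foldr (extend A) ∅ ∨ ¬ HasVC (del A (insert v (l.foldr (extend A) ∅)))
        (2 * (#(l.foldr (extend A) ∅) + 1)) (2 * coverNum A) := by
  induction l with
  | nil =>
    refine ⟨?_, by simp⟩
    have : del A ∅ = A := by ext; simp [del]
    simpa [this] using hasVC_coverNum A
  | cons a l ih =>
    rw [List.foldr_cons]
    generalize l.foldr (extend A) ∅ = S at ih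
    by_cases h : HasVC (del A (insert a S)) (2 * (#S + 1)) (2 * coverNum A)
    · have he : extend A a S = insert a S := by rw [extend, if_pos (hasVC_iff.2 h)]
      rw [he]
      have hc := card_insert_le a S
      refine ⟨?_, fun v hv => ?_⟩
      · obtain ⟨C, hC, hB⟩ := h
        exact ⟨C, hC, by omega⟩
      · rcases List.mem_cons.1 hv with rfl | hv
        · exact Or.inl (mem_insert_self _ _)
        · refine (ih.2 v hv).imp (mem_insert_of_mem) fun hn h' => hn ?_
          have : insert v (insert a S) = insert v S ∪ {a} := by
            ext; simp only [mem_union, mem_insert, mem_singleton]; tauto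
          rw [this, ← del_del] at h'
          by_cases haS : a ∈ S
          · obtain ⟨C, hC, hB⟩ := h'
            rw [insert_eq_self.2 haS] at hB
            rw [del_del, union_eq_left.2 (by simpa using Or.inr haS)] at hC
            exact ⟨C, hC, hB⟩
          · refine h'.of_del ?_
            rw [card_insert_of_notMem haS, card_singleton]
            omega
    · have he : extend A a S = S := by rw [extend, if_neg (by rwa [hasVC_iff])]
      rw [he]
      refine ⟨ih.1, fun v hv => ?_⟩
      rcases List.mem_cons.1 hv with rfl | hv
      · exact Or.inr h
      · exact ih.2 v hv

/-- A vertex of a completion that was not selected could have been added, against its rejection. So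
the completion lies inside the selected set, which is therefore already a cover. -/
theorem minCover_spec (A : Fin n → Fin n → Bool) :
    Cov A (minCover A) ∧ #(minCover A) = coverNum A := by
  obtain ⟨h1, h2⟩ := extend_foldr_spec (A := A) (List.finRange n)
  change HasVC (del A (minCover A)) (2 * #(minCover A)) _ at h1
  have h3 : ∀ v, v ∉ minCover A → ¬ HasVC (del A (insert v (minCover A)))
      (2 * (#(minCover A) + 1)) (2 * coverNum A) := fun v hv =>
    (h2 v (List.mem_finRange v)).resolve_left hv
  obtain ⟨C, hC, hB⟩ := h1
  have key : ∀ v ∈ C, v ∈ minCover A := by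
    intro v hv
    by_contra hn
    refine h3 v hn ?_
    rw [insert_eq, union_comm, ← del_del]
    exact hC.hasVC_del (singleton_subset_iff.2 hv) (by rw [card_singleton]; omega) hB
  have hcov : Cov A (minCover A) := by
    intro u v huv
    by_contra hcon
    push Not at hcon
    rcases hC u v (del_eq_true.2 ⟨huv, hcon⟩) with h | h
    · exact hcon.1 (key u h)
    · exact hcon.2 (key v h)
  exact ⟨hcov, le_antisymm (by omega) (coverNum_le ⟨_, hcov, by omega⟩)⟩

/-- The bound for the number of steps of the whole algorithm. -/
noncomputable def totalPot (A : Fin n → Fin n → Bool) : ℕ :=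
  (n + 1) * Nat.fib (2 * coverNum A + 2 - lp A + 1)

/-- This bounds all the decision problems that are solved: their budgets stay below the optimum, and
chosen vertices do not lower `c + lp`. -/
theorem pot_le_totalPot {A' : Fin n → Fin n → Bool} {c B : ℕ} (hB : B ≤ 2 * coverNum A)
    (h : lp A ≤ c + lp A') : pot B (A', c) ≤ totalPot A :=
  Nat.mul_le_mul (Nat.succ_le_succ ((card_le_univ _).trans_eq (Fintype.card_fin n)))
    (Nat.fib_mono (by simp only; omega))

end VertexCover

/-! ### Programs for the branching algorithm -/

namespace TreeWhile.PT

open VertexCover Polynomial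

variable {ι : Type} {n W : ι → ℕ} {E : ι → Data} {A : ∀ i, Fin (n i) → Fin (n i) → Bool}
  {S T : ∀ i, Finset (Fin (n i))} {v : ∀ i, Fin (n i)}

theorem del (hn : PT n W E fun i => num (n i)) (hA : PT n W E fun i => mat (A i))
    (hS : PT n W E fun i => encodeSet (S i)) :
    PT n W E fun i => mat (VertexCover.del (A i) (S i)) := by
  refine matTab hn ?_
  exact (matGet (hA.pull2 _) here.there here).and
    ((mem (hS.pull2 _) here.there).not.and (mem (hS.pull2 _) here).not)

theorem insert (hn : PT n W E fun i => num (n i)) (hv : PT n W E fun i => num (v i))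
    (hS : PT n W E fun i => encodeSet (S i)) :
    PT n W E fun i => encodeSet (insert (v i) (S i)) := by
  refine setTab hn (congr ((finEq (j := fun p : Σ i, Fin (n i) => p.2) here (hv.pull1 _)).or
    (mem (hS.pull1 _) here)) fun p => ?_)
  rw [← Bool.decide_or]
  simp only [Finset.mem_insert]

theorem empty (hn : PT n W E fun i => num (n i)) :
    PT n W E fun i => encodeSet (∅ : Finset (Fin (n i))) :=
  setTab hn ((ofBool_const false).congr fun p => by simp)

theorem singleton (hn : PT n W E fun i => num (n i)) (hv : PT n W E fun i => num (v i)) :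
    PT n W E fun i => encodeSet {v i} := by
  refine congr (insert hn hv (empty hn)) fun i => ?_
  simp

theorem union (hn : PT n W E fun i => num (n i)) (hS : PT n W E fun i => encodeSet (S i))
    (hT : PT n W E fun i => encodeSet (T i)) : PT n W E fun i => encodeSet (S i ∪ T i) := by
  refine setTab hn (congr ((mem (hS.pull1 _) here).or (mem (hT.pull1 _) here)) fun p => ?_)
  rw [← Bool.decide_or]
  simp only [Finset.mem_union]

theorem nbr (hn : PT n W E fun i => num (n i)) (hA : PT n W E fun i => mat (A i))
    (hv : PT n W E fun i => num (v i)) :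
    PT n W E fun i => encodeSet (VertexCover.nbr (A i) (v i)) := by
  refine setTab hn (congr (matGet (hA.pull1 _) (hv.pull1 _) here) fun p => ?_)
  simp

theorem memSupp (hn : PT n W E fun i => num (n i)) (hA : PT n W E fun i => mat (A i))
    (hv : PT n W E fun i => num (v i)) :
    PT n W E fun i => Data.ofBool (decide (v i ∈ supp (A i))) := by
  refine congr (ex (P := fun i w => A i (v i) w) hn
    (matGet (hA.pull1 _) (hv.pull1 _) here)) fun i => ?_
  simp only [mem_supp]

/-- Values of the linear program and cardinalities are polynomially bounded. -/
theorem lp_le_eval (hA' : ∀ i, Sym (A i)) (i : ι) :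
    VertexCover.lp (A i) ≤ (X : Polynomial ℕ).eval (n i) := by
  rw [eval_X]
  exact (lp_le_card_supp (hA' i)).trans ((Finset.card_le_univ _).trans_eq (Fintype.card_fin _))

theorem card_le_eval (i : ι) : (S i).card ≤ (X : Polynomial ℕ).eval (n i) := by
  rw [eval_X]
  exact (Finset.card_le_univ _).trans_eq (Fintype.card_fin _)

theorem takeable (hA' : ∀ i, Sym (A i)) (hn : PT n W E fun i => num (n i))
    (hA : PT n W E fun i => mat (A i)) (hv : PT n W E fun i => num (v i)) :
    PT n W E fun i => Data.ofBool (VertexCover.takeable (A i) (v i)) :=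
  (matGet hA hv hv).or (le X (lp_le_eval hA') (lp (fun i => (hA' i).del _) hn
    (del hn hA (singleton hn hv))).succ.succ (lp hA' hn hA))

theorem branchable (hA' : ∀ i, Sym (A i)) (hn : PT n W E fun i => num (n i))
    (hA : PT n W E fun i => mat (A i)) (hv : PT n W E fun i => num (v i)) :
    PT n W E fun i => Data.ofBool (VertexCover.branchable (A i) (v i)) := by
  have hN := nbr hn hA hv
  have h1 : ∀ i, Sym (VertexCover.del (A i) (VertexCover.nbr (A i) (v i))) :=
    fun i => (hA' i).del _
  refine (memSupp hn hA hv).and (le (X + 2 * X) (fun i => ?_) (lp hA' hn hA).succ.succ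
    (add X (lp_le_eval h1) (lp h1 hn (del hn hA hN)) (two_mul X (card_le_eval) (card hn hN))))
  have h2 := lp_le_eval h1 i
  have h3 := card_le_eval (S := fun i => VertexCover.nbr (A i) (v i)) i
  simp only [eval_X, eval_add, eval_mul, eval_ofNat] at *
  omega

theorem greedyStep (hA' : ∀ i, Sym (A i)) (hn : PT n W E fun i => num (n i))
    (hA : PT n W E fun i => mat (A i)) (hv : PT n W E fun i => num (v i))
    (hS : PT n W E fun i => encodeSet (S i)) :
    PT n W E fun i => encodeSet (VertexCover.greedyStep (A i) (v i) (S i)) := by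
  have h1 : ∀ (S : ∀ i, Finset (Fin (n i))) i, Sym (VertexCover.del (A i) (S i)) :=
    fun S i => (hA' i).del _
  have hi := insert hn hv hS
  refine congr (ite (le X (lp_le_eval (h1 S)) (lp (h1 _) hn (del hn hA hi)).succ.succ
    (lp (h1 S) hn (del hn hA hS))) hi hS) fun i => ?_
  rw [VertexCover.greedyStep]
  split_ifs <;> rfl

theorem greedy (hA' : ∀ i, Sym (A i)) (hn : PT n W E fun i => num (n i))
    (hA : PT n W E fun i => mat (A i)) (hS : PT n W E fun i => encodeSet (S i)) :
    PT n W E fun i => encodeSet (VertexCover.greedy (A i) (S i)) := by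
  refine foldr (α := fun i => Finset (Fin (n i))) (op := fun i => VertexCover.greedyStep (A i))
    (fun i s => encodeSet s) hn hS ?_
  refine greedyStep ?_ ?_ ?_ here here.there
  exacts [fun p => hA' p.1, hn.pull2 _, hA.pull2 _]

theorem isolatedBy (hn : PT n W E fun i => num (n i)) (hA : PT n W E fun i => mat (A i))
    (hS : PT n W E fun i => encodeSet (S i)) :
    PT n W E fun i => encodeSet (VertexCover.isolatedBy (A i) (S i)) := by
  refine setTab hn (congr (((memSupp (hn.pull1 _) (hA.pull1 _) here)).and
    ((mem (hS.pull1 _) here).not.and (all (ι := Σ i, Fin (n i)) (n := fun p => n p.1)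
      (P := fun p w => !A p.1 p.2 w || decide (w ∈ S p.1)) (hn.pull1 _) ?_))) fun p => ?_)
  · exact (matGet (hA.pull2 _) here.there here).not.or (mem (hS.pull2 _) here)
  · congr 1
    rw [Bool.eq_iff_iff]
    simp only [Bool.and_eq_true, decide_eq_true_eq, Bool.not_eq_true', decide_eq_false_iff_not,
      Bool.or_eq_true, mem_isolatedBy]
    simp only [Bool.eq_false_iff, ne_eq, imp_iff_not_or]

theorem adjTo (hn : PT n W E fun i => num (n i)) (hA : PT n W E fun i => mat (A i))
    (hS : PT n W E fun i => encodeSet (S i)) (hv : PT n W E fun i => num (v i)) :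
    PT n W E fun i => Data.ofBool (VertexCover.adjTo (A i) (S i) (v i)) := by
  refine congr (ex (P := fun i a => decide (a ∈ S i) && A i a (v i)) hn
    ((mem (hS.pull1 _) here).and (matGet (hA.pull1 _) here (hv.pull1 _)))) fun i => ?_
  congr 1
  rw [VertexCover.adjTo, decide_eq_decide]
  simp

theorem fold (hn : PT n W E fun i => num (n i)) (hA : PT n W E fun i => mat (A i))
    (hv : PT n W E fun i => num (v i)) (hS : PT n W E fun i => encodeSet (S i))
    (hT : PT n W E fun i => encodeSet (T i)) :
    PT n W E fun i => mat (VertexCover.fold (A i) (v i) (S i) (T i)) := by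
  have hl : PT n W E fun i => Data.ofBool
      (decide (∃ u, (decide (u ∈ T i) && VertexCover.adjTo (A i) (T i) u) = true)) :=
    ex (P := fun i u => decide (u ∈ T i) && VertexCover.adjTo (A i) (T i) u) hn
      ((mem (hT.pull1 _) here).and (adjTo (hn.pull1 _) (hA.pull1 _) (hT.pull1 _) here))
  have h2 : ∀ j : ∀ p : Σ i, Fin (n i) × Fin (n i), Fin (n p.1),
      PT (ι := Σ i, Fin (n i) × Fin (n i)) (fun p => n p.1) (fun p => W p.1)
        (fun p => Data.cons (num p.2.2) (Data.cons (num p.2.1) (E p.1))) (fun p => num (j p)) →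
      PT (ι := Σ i, Fin (n i) × Fin (n i)) (fun p => n p.1) (fun p => W p.1)
        (fun p => Data.cons (num p.2.2) (Data.cons (num p.2.1) (E p.1)))
        fun p => Data.ofBool (!decide (j p ∈ S p.1) && VertexCover.adjTo (A p.1) (T p.1) (j p)) :=
    fun j hj => (mem (hS.pull2 _) hj).not.and (adjTo (hn.pull2 _) (hA.pull2 _) (hT.pull2 _) hj)
  refine matTab hn (congr (ite
    (finEq (j := fun p : Σ i, Fin (n i) × Fin (n i) => p.2.1) here.there (hv.pull2 _))
    (ite (finEq (j := fun p : Σ i, Fin (n i) × Fin (n i) => p.2.2) here (hv.pull2 _))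
      (hl.pull2 _) (h2 (fun p => p.2.2) here))
    (ite (finEq (j := fun p : Σ i, Fin (n i) × Fin (n i) => p.2.2) here (hv.pull2 _))
      (h2 (fun p => p.2.1) here.there)
      (matGet ((del hn hA hS).pull2 _) here.there here))) fun p => ?_)
  simp only [VertexCover.fold, decide_eq_true_eq, Bool.and_eq_true]
  split_ifs <;> congr!

/-- Encoding of a subproblem. -/
def encItem {m : ℕ} (it : Item m) : Data := Data.cons (mat it.1) (num it.2)

theorem itemMat {it : ∀ i, Item (n i)} (h : PT n W E fun i => encItem (it i)) :
    PT n W E fun i => mat (it i).1 := h.hd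

theorem itemNum {it : ∀ i, Item (n i)} (h : PT n W E fun i => encItem (it i)) :
    PT n W E fun i => num (it i).2 := h.tl

theorem takeItem {it : ∀ i, Item (n i)} (hn : PT n W E fun i => num (n i))
    (h : PT n W E fun i => encItem (it i)) (hS : PT n W E fun i => encodeSet (S i)) :
    PT n W E fun i => encItem (VertexCover.takeItem (it i) (S i)) := by
  refine (del hn h.itemMat hS).cons (congr (add (2 * X) (fun i => ?_)
    (two_mul X card_le_eval (card hn hS)) h.itemNum) fun i => ?_)
  · have := card_le_eval (S := S) i
    simp only [eval_X, eval_mul, eval_ofNat] at *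
    omega
  · rw [add_comm]; rfl

theorem foldItem {it : ∀ i, Item (n i)} (hA' : ∀ i, Sym (it i).1)
    (hn : PT n W E fun i => num (n i))
    (h : PT n W E fun i => encItem (it i)) (hv : PT n W E fun i => num (v i)) :
    PT n W E fun i => encItem (VertexCover.foldItem (it i) (v i)) := by
  have hW : PT n W E fun i => encodeSet (foldSet (it i).1 (v i)) :=
    greedy hA' hn h.itemMat (nbr hn h.itemMat hv)
  have hZ := isolatedBy hn h.itemMat hW
  refine (fold hn h.itemMat hv (union hn hZ hW) hW).cons (congr (add (2 * X) (fun i => ?_)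
    (two_mul X card_le_eval (card hn hZ)) h.itemNum) fun i => ?_)
  · have := card_le_eval (S := fun i =>
      VertexCover.isolatedBy (it i).1 (foldSet (it i).1 (v i))) i
    simp only [eval_X, eval_mul, eval_ofNat] at *
    omega
  · rw [add_comm]; rfl

/-- Encoding of a list of subproblems on top of a stack. -/
def encItems {m : ℕ} (l : List (Item m)) (r : Data) : Data :=
  l.foldr (fun it d => Data.cons (encItem it) d) r

/-- The state of the search after the reduction of a subproblem. -/
def afterKids {m : ℕ} (r t t' : Data) : Option (List (Item m)) → Data
  | none => Data.cons Data.nil t'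
  | some l => Data.cons (encItems l r) t

section kids

variable {B : ι → ℕ} {it : ∀ i, Item (n i)} {r t t' : ι → Data}

theorem kids_of_not_branchable (hA' : ∀ i, Sym (it i).1)
    (h1 : ∀ i, decide ((it i).2 + VertexCover.lp (it i).1 ≤ B i) = true)
    (h2 : ∀ i, findFin (VertexCover.takeable (it i).1) = none)
    (h3 : ∀ i, findFin (VertexCover.branchable (it i).1) = none)
    (hn : PT n W E fun i => num (n i))
    (h : PT n W E fun i => encItem (it i)) (hr : PT n W E r) (ht : PT n W E t)
    (ht' : PT n W E t') :
    PT n W E fun i => afterKids (r i) (t i) (t' i) (VertexCover.kids (B i) (it i)) := by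
  have hA := h.itemMat
  refine findCase (P := fun i v => decide (v ∈ supp (it i).1)) hn
    (memSupp (hn.pull1 _) (hA.pull1 _) here) ?_ ?_
  · refine congr (nil.cons ht'.sub) fun i => ?_
    rw [VertexCover.kids, if_pos (h1 i), h2, h3, i.2]
    rfl
  · refine congr (((foldItem (fun p => hA' _) (hn.pull1 _) (h.pull1 _) here).cons
      (hr.pull1 _)).cons (ht.pull1 _)) fun p => ?_
    rw [VertexCover.kids, if_pos (h1 _), h2, h3, p.2]
    rfl

theorem kids_of_not_takeable (hA' : ∀ i, Sym (it i).1)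
    (h1 : ∀ i, decide ((it i).2 + VertexCover.lp (it i).1 ≤ B i) = true)
    (h2 : ∀ i, findFin (VertexCover.takeable (it i).1) = none)
    (hn : PT n W E fun i => num (n i))
    (h : PT n W E fun i => encItem (it i)) (hr : PT n W E r) (ht : PT n W E t)
    (ht' : PT n W E t') :
    PT n W E fun i => afterKids (r i) (t i) (t' i) (VertexCover.kids (B i) (it i)) := by
  have hA := h.itemMat
  refine findCase (P := fun i v => VertexCover.branchable (it i).1 v) hn
    (branchable (fun p => hA' _) (hn.pull1 _) (hA.pull1 _) here) ?_ ?_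
  · exact kids_of_not_branchable (fun i => hA' _) (fun i => h1 _) (fun i => h2 _) (fun i => i.2)
      hn.sub h.sub hr.sub ht.sub ht'.sub
  · refine congr (((takeItem (hn.pull1 _) (h.pull1 _) (singleton (hn.pull1 _) here)).cons
      ((takeItem (hn.pull1 _) (h.pull1 _) (nbr (hn.pull1 _) (hA.pull1 _) here)).cons
      (hr.pull1 _))).cons (ht.pull1 _)) fun p => ?_
    rw [VertexCover.kids, if_pos (h1 _), h2, p.2]
    rfl

theorem kids (hA' : ∀ i, Sym (it i).1) (hB' : ∀ i, B i ≤ 2 * n i)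
    (hn : PT n W E fun i => num (n i)) (hB : PT n W E fun i => num (B i))
    (h : PT n W E fun i => encItem (it i)) (hr : PT n W E r) (ht : PT n W E t)
    (ht' : PT n W E t') :
    PT n W E fun i => afterKids (r i) (t i) (t' i) (VertexCover.kids (B i) (it i)) := by
  have hA := h.itemMat
  refine cases (b := fun i => decide ((it i).2 + VertexCover.lp (it i).1 ≤ B i))
    (le (2 * X) (fun i => by simpa using hB' i) (congr (add X (lp_le_eval hA') (lp hA' hn hA)
      h.itemNum) fun i => by rw [add_comm]) hB) ?_ ?_
  · refine findCase (ι := {i // _}) (n := fun i => n i.1)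
      (P := fun i v => VertexCover.takeable (it i.1).1 v) hn.sub
      (takeable (fun p => hA' _) (hn.sub.pull1 _) (hA.sub.pull1 _) here) ?_ ?_
    · exact kids_of_not_takeable (fun i => hA' _) (fun i => i.1.2) (fun i => i.2)
        hn.sub.sub h.sub.sub hr.sub.sub ht.sub.sub ht'.sub.sub
    · refine congr (((takeItem (hn.pull1 _) (h.pull1 _)
        (singleton (hn.pull1 _) here)).cons (hr.pull1 _)).cons (ht.pull1 _)) fun p => ?_
      rw [VertexCover.kids, if_pos p.1.1.2, p.2]
      rfl
  · refine congr ((hr.cons ht).sub) fun i => ?_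
    rw [VertexCover.kids, i.2]
    rfl

end kids

end TreeWhile.PT

/-! ### The program for a minimum vertex cover -/

namespace TreeWhile.PT

open VertexCover Polynomial

variable {ι : Type} {n W : ι → ℕ} {E : ι → Data} {A : ∀ i, Fin (n i) → Fin (n i) → Bool}

/-- Encoding of a state of the search, together with the size and the budget. -/
def encSearch {m : ℕ} (B : ℕ) (s : List (Item m) × Bool) : Data :=
  Data.cons (encItems s.1 Data.nil)
    (Data.cons (Data.ofBool s.2) (Data.cons (num m) (num B)))

theorem ne_nil_of_hd_ne {m B : ℕ} {s : List (Item m) × Bool}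
    (h : (encSearch B s).hd ≠ Data.nil) : s.1 ≠ [] := by
  rintro hs
  simp [encSearch, hs, encItems, Data.hd] at h

/-- The body of the loop sees only the encoded state, which is why the size and the budget are
stored there. -/
theorem searchStep {B : ι → ℕ} {s : ∀ i, List (Item (n i)) × Bool}
    (hs : ∀ i, (s i).1 ≠ []) (hA : ∀ i, ∀ k ∈ (s i).1, Sym k.1) (hB : ∀ i, B i ≤ 2 * n i) :
    PT n W (fun i => encSearch (B i) (s i))
      fun i => encSearch (B i) (VertexCover.searchStep (B i) (s i)) := by
  let E' := fun i => encSearch (B i) (s i)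
  have hcons : ∀ i, (s i).1 = (s i).1.head (hs i) :: (s i).1.tail := fun i => by simp
  have hst : PT n W E' fun i =>
      encItems ((s i).1.head (hs i) :: (s i).1.tail) Data.nil :=
    id.hd.congr fun i => by rw [← hcons i]; rfl
  have hit : PT n W E' fun i => encItem ((s i).1.head (hs i)) := hst.hd
  have hr : PT n W E' fun i => encItems (s i).1.tail Data.nil := hst.tl
  have ht : PT n W E' fun i =>
    Data.cons (Data.ofBool (s i).2) (Data.cons (num (n i)) (num (B i))) := id.tl
  have hn : PT n W E' fun i => num (n i) := ht.tl.hd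
  have hB' : PT n W E' fun i => num (B i) := ht.tl.tl
  have ht' : PT n W E' fun i =>
    Data.cons (Data.ofBool true) (Data.cons (num (n i)) (num (B i))) :=
      (ofBool_const true).cons ht.tl
  refine congr (kids (fun i => hA i _ (List.head_mem _)) hB hn hB' hit hr ht ht') fun i => ?_
  generalize hs i = hx
  generalize s i = x at hx
  obtain ⟨_ | ⟨a, l⟩, b⟩ := x
  · exact absurd rfl hx
  · simp only [List.head_cons, List.tail_cons, VertexCover.searchStep]
    cases VertexCover.kids (B i) a with
    | none => rfl
    | some l => simp only [afterKids, encSearch, encItems, List.foldr_append]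

/-- The decision problem is solved in time bounded by the potential. -/
theorem hasVC {B c : ι → ℕ} (hA' : ∀ i, Sym (A i)) (hB' : ∀ i, B i ≤ 2 * n i)
    (hW : ∀ i, pot (B i) (A i, c i) ≤ W i) (hn : PT n W E fun i => num (n i))
    (hA : PT n W E fun i => mat (A i)) (hc : PT n W E fun i => num (c i))
    (hB : PT n W E fun i => num (B i)) :
    PT n W E fun i => Data.ofBool (VertexCover.hasVC (A i) (c i) (B i)) := by
  have h : PT n W E fun i => Data.cons Data.nil
      (Data.cons (Data.ofBool (VertexCover.hasVC (A i) (c i) (B i)))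
        (Data.cons (num (n i)) (num (B i)))) := by
    refine whileLoop (σ := fun i => List (Item (n i)) × Bool) (st := fun i => encSearch (B i))
      (next := fun i => VertexCover.searchStep (B i))
      (inv := fun i => SearchInv (B i) (A i, c i)) (meas := fun i => searchMeas (B i))
      (init := fun i => ([(A i, c i)], false)) ?_ ?_ ?_ ?_ 1 ?_ ?_ ?_
    · exact ((hA.cons hc).cons nil).cons ((ofBool_const false).cons (hn.cons hB))
    · intro i
      refine ⟨by simpa using hA' i, by simp⟩
    · exact fun i s h hs => (searchStep_spec h (ne_nil_of_hd_ne hs)).1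
    · exact fun i s h hs => (searchStep_spec h (ne_nil_of_hd_ne hs)).2
    · intro i
      have := hW i
      simp only [searchMeas, List.map_cons, List.map_nil, List.sum_cons, List.sum_nil, eval_one]
      omega
    · intro i s h hs
      have hs' : s.1 = [] := by
        rcases hs'' : s.1 with _ | ⟨a, l⟩
        · rfl
        · simp [encSearch, hs'', encItems, Data.hd, encItem] at hs
      have h2 := h.2
      simp only [hs', List.not_mem_nil, false_and, exists_false, or_false] at h2
      have : VertexCover.hasVC (A i) (c i) (B i) = s.2 := by
        rw [Bool.eq_iff_iff, hasVC_iff, h2]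
      rw [encSearch, hs', this]
      rfl
    · exact searchStep (fun p => ne_nil_of_hd_ne p.2.2) (fun p => p.2.1.1) fun p => hB' _
  exact h.tl.hd

/-- The length of a vector. -/
theorem length {f : ∀ i, Fin (n i) → Data} (hf : PT n W E fun i => vec (f i)) :
    PT n W E fun i => num (n i) := by
  have h : PT n W (fun i => Data.cons (Data.ofList ((List.ofFn (f i)).drop (n i - n i)))
      (num (n i - n i))) fun i => Data.cons (Data.ofList ((List.ofFn (f i)).drop (n i - 0)))
      (num (n i - 0)) := by
    -- No counter is available yet, so the loop is driven by the list itself, its remaining part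
    -- being the first component of the state.
    refine loop (V := W) (K := n)
      (X := fun i j => Data.cons (Data.ofList ((List.ofFn (f i)).drop (n i - j))) (num (n i - j)))
      (X + 1) (fun i => by simp) (fun i => ?_) (fun i j hj => ?_) ?_
    · rw [Nat.sub_zero, List.drop_of_length_le (by simp)]; rfl
    · rw [List.drop_eq_getElem_cons (by simp; omega)]
      simp [Data.ofList, Data.hd]
    · refine congr (id.hd.tl.cons id.tl.succ) fun p => ?_
      have := p.2.2
      have he : n p.1 - p.2 = n p.1 - (p.2 + 1) + 1 := by omega
      rw [List.drop_eq_getElem_cons (by simp; omega), he]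
      simp [Data.ofList, Data.hd, Data.tl]
  refine congr ((congr (hf.cons nil) fun i => ?_).comp h).tl fun i => rfl
  simp [vec, num]

/-- The size of a minimum vertex cover is computable. -/
theorem coverNum (hA' : ∀ i, Sym (A i)) (hW : ∀ i, totalPot (A i) ≤ W i)
    (hn : PT n W E fun i => num (n i)) (hA : PT n W E fun i => mat (A i)) :
    PT n W E fun i => num (VertexCover.coverNum (A i)) := by
  -- The candidate grows from zero and stops at the first success, so no budget above the optimum is
  -- ever tested; a larger one would break the time bound.
  refine congr (down (s := fun i j => num (min (n i - j) (VertexCover.coverNum (A i)))) X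
    (fun i => by simp) hn (nil.congr fun i => by simp [num]) ?_) fun i => ?_
  · have hk : PT (ι := Σ i, Fin (n i)) (fun p => n p.1) (fun p => W p.1)
        (fun p => Data.cons (num p.2) (Data.cons (num (min (n p.1 - (p.2 + 1))
          (VertexCover.coverNum (A p.1)))) (E p.1)))
        fun p => num (min (n p.1 - (p.2 + 1)) (VertexCover.coverNum (A p.1))) := here.there
    refine congr (ite (hasVC (c := fun _ => 0) (fun p => hA' p.1) (fun p => ?_) (fun p => ?_)
      (hn.pull2 _) (hA.pull2 _) nil (two_mul X (fun p => ?_) hk)) hk hk.succ) fun p => ?_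
    · have := coverNum_le_card (A p.1); omega
    · exact (pot_le_totalPot (by omega) (by omega)).trans (hW p.1)
    · rw [eval_X]; omega
    · have h1 := p.2.2
      by_cases h : HasVC (A p.1) 0 (2 * min (n p.1 - (p.2 + 1)) (VertexCover.coverNum (A p.1)))
      · rw [if_pos (hasVC_iff.2 h)]
        rw [hasVC_iff_coverNum_le] at h
        congr 1; omega
      · rw [if_neg (by rwa [hasVC_iff])]
        rw [hasVC_iff_coverNum_le] at h
        congr 1; omega
  · rw [Nat.sub_zero, min_eq_right (coverNum_le_card (A i))]

/-- A minimum vertex cover is computable. -/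
theorem minCover (hA' : ∀ i, Sym (A i)) (hW : ∀ i, totalPot (A i) ≤ W i)
    (hn : PT n W E fun i => num (n i)) (hA : PT n W E fun i => mat (A i)) :
    PT n W E fun i => encodeSet (VertexCover.minCover (A i)) := by
  have hk := coverNum hA' hW hn hA
  refine foldr (α := fun i => Finset (Fin (n i))) (op := fun i => extend (A i))
    (fun i s => encodeSet s) hn (empty hn) ?_
  have hS : PT (ι := Σ i, Fin (n i) × Finset (Fin (n i))) (fun p => n p.1) (fun p => W p.1)
      (fun p => Data.cons (num p.2.1) (Data.cons (encodeSet p.2.2) (E p.1)))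
      fun p => encodeSet p.2.2 := here.there
  have hi := insert (v := fun p : Σ i, Fin (n i) × Finset (Fin (n i)) => p.2.1)
    (hn.pull2 _) here hS
  refine congr (ite (hasVC (fun p => (hA' p.1).del _) (fun p => ?_) (fun p => ?_)
    (hn.pull2 _) (del (hn.pull2 _) (hA.pull2 _) hi) (two_mul (X + 1) (fun p => ?_)
      (card (hn.pull2 _) hS).succ)
    (two_mul X (fun p => ?_) (hk.pull2 _))) hi hS) fun p => ?_
  · have := coverNum_le_card (A p.1); omega
  · refine (pot_le_totalPot le_rfl ?_).trans (hW p.1)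
    have := lp_le_del (A p.1) (Insert.insert p.2.1 p.2.2)
    have := Finset.card_insert_le p.2.1 p.2.2
    omega
  · have := card_le_eval (S := fun p : Σ i, Fin (n i) × Finset (Fin (n i)) => p.2.2) p
    simp only [eval_X, eval_add, eval_one] at *
    omega
  · rw [eval_X]; exact coverNum_le_card (A p.1)
  · rw [extend]
    split_ifs <;> rfl

end TreeWhile.PT

/-! ### Comparison with the graph parameters and the golden ratio bound -/

namespace VertexCover

open TreeWhile Finset

/-- The adjacency matrix of a graph. -/
noncomputable def adj {n : ℕ} (G : SimpleGraph (Fin n)) (u v : Fin n) : Bool :=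
  open Classical in decide (G.Adj u v)

theorem adj_iff {n : ℕ} {G : SimpleGraph (Fin n)} {u v : Fin n} :
    adj G u v = true ↔ G.Adj u v := by simp [adj]

theorem sym_adj {n : ℕ} (G : SimpleGraph (Fin n)) : Sym (adj G) := by
  intro u v
  rw [Bool.eq_iff_iff, adj_iff, adj_iff, G.adj_comm]

theorem cov_adj_iff {n : ℕ} {G : SimpleGraph (Fin n)} {C : Finset (Fin n)} :
    Cov (adj G) C ↔ G.IsVertexCover (C : Set (Fin n)) := by
  simp only [Cov, adj_iff, SimpleGraph.IsVertexCover, mem_coe]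

theorem vertexCoverNum_eq {n : ℕ} (G : SimpleGraph (Fin n)) :
    G.vertexCoverNum = (coverNum (adj G) : ℕ∞) := by
  obtain ⟨h1, h2⟩ := minCover_spec (adj G)
  refine le_antisymm ?_ ?_
  · have := (cov_adj_iff.1 h1).vertexCoverNum_le
    rwa [Set.encard_coe_eq_coe_finsetCard, h2] at this
  · obtain ⟨s, hs, hcov⟩ := G.vertexCoverNum_exists
    classical
    rw [← hs, ← Set.coe_toFinset s, Set.encard_coe_eq_coe_finsetCard]
    refine Nat.cast_le.2 (coverNum_le ⟨s.toFinset, cov_adj_iff.2 (by simpa using hcov), ?_⟩)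
    omega

/-- Half of an integral two-cover is feasible. This direction is the useful one, since a smaller
`vc*` only enlarges the allowed time. -/
theorem fractionalVertexCoverNum_le {n : ℕ} (G : SimpleGraph (Fin n)) :
    G.fractionalVertexCoverNum ≤ (lp (adj G) : ℝ) / 2 := by
  obtain ⟨x, hx, hs⟩ := exists_lp (adj G)
  refine csInf_le ⟨0, ?_⟩ ⟨fun v => (x v : ℝ) / 2, ⟨fun v => by positivity, ?_⟩, ?_⟩
  · rintro w ⟨y, hy, rfl⟩
    exact sum_nonneg fun v _ => hy.1 v
  · intro u v huv
    have : (2 : ℝ) ≤ x u + x v := by exact_mod_cast hx u v (adj_iff.2 huv)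
    linarith
  · rw [← sum_div, ← hs]
    push_cast
    rfl

theorem fib_le_rpow (m : ℕ) : (Nat.fib (m + 1) : ℝ) ≤ (2.6181 : ℝ) ^ ((m : ℝ) / 2) := by
  -- With `b` the square root of `2.6181`, this is `1 + b ≤ b ^ 2`, which is what the Fibonacci
  -- recurrence needs.
  have hb : (2.6181 : ℝ) ^ ((1 : ℝ) / 2) ≤ 1.6181 := by
    rw [← Real.sqrt_eq_rpow, Real.sqrt_le_left (by norm_num)]
    norm_num
  have h1 : (1 : ℝ) ≤ (2.6181 : ℝ) ^ ((1 : ℝ) / 2) :=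
    Real.one_le_rpow (by norm_num) (by norm_num)
  induction m using Nat.twoStepInduction with
  | zero => simp
  | one => simpa using h1
  | more m ih0 ih1 =>
    have e1 : (2.6181 : ℝ) ^ (((m + 1 : ℕ) : ℝ) / 2) =
        (2.6181 : ℝ) ^ ((m : ℝ) / 2) * (2.6181 : ℝ) ^ ((1 : ℝ) / 2) := by
      rw [← Real.rpow_add (by norm_num)]; congr 1; push_cast; ring
    have e2 : (2.6181 : ℝ) ^ (((m + 2 : ℕ) : ℝ) / 2) = (2.6181 : ℝ) ^ ((m : ℝ) / 2) * 2.6181 := by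
      conv_rhs => rw [← Real.rpow_add_one (by norm_num)]
      congr 1; push_cast; ring
    have hpos : (0 : ℝ) < (2.6181 : ℝ) ^ ((m : ℝ) / 2) := Real.rpow_pos_of_pos (by norm_num) _
    rw [e1] at ih1
    rw [e2, Nat.fib_add_two]
    push_cast
    nlinarith

end VertexCover

theorem mainTheorem3 :
    ∃ (program : TreeWhile.Cmd) (p : Polynomial ℕ), ∀ (n : ℕ) (G : SimpleGraph (Fin n)),
      ∃ (t : ℕ) (S : Finset (Fin n)),
        TreeWhile.Outputs program (TreeWhile.encodeGraph G) t (TreeWhile.encodeSet S) ∧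
        G.IsVertexCover (S : Set (Fin n)) ∧
        (S.card : ℕ∞) = G.vertexCoverNum ∧
        (t : ℝ) ≤ ((p.eval n : ℕ) : ℝ) *
          (2.6181 : ℝ) ^ ((G.vertexCoverNum.toNat : ℝ) - G.fractionalVertexCoverNum) := by
  obtain ⟨c, q, h⟩ := TreeWhile.PT.minCover (ι := Σ n, SimpleGraph (Fin n)) (n := fun p => p.1)
    (W := fun p => VertexCover.totalPot (VertexCover.adj p.2))
    (E := fun p => TreeWhile.encodeGraph p.2) (A := fun p => VertexCover.adj p.2)
    (fun p => VertexCover.sym_adj p.2) (fun p => le_rfl)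
    (TreeWhile.PT.length (n := fun p : Σ n, SimpleGraph (Fin n) => p.1) TreeWhile.PT.id)
    TreeWhile.PT.id
  -- The outer assignments wrap the input as a one-element stack and unwrap the result. The `6` is
  -- `2 * 3`: the `2` bounds `W + 1` by `2 * W`, and the `3` exceeds `2.6181`, the cost of the
  -- offset `2` in the potential.
  refine ⟨.seq (.assign 0 (.cons (.var 0) .nil)) (.seq c (.assign 0 (.hd (.var 0)))),
    (q + 10) * (6 * (Polynomial.X + 1)), fun n G => ?_⟩
  obtain ⟨t, ht, hr⟩ := h ⟨n, G⟩ TreeWhile.Data.nil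
  obtain ⟨h1, h2⟩ := VertexCover.minCover_spec (VertexCover.adj G)
  have hrun := (TreeWhile.Run.assign (e := .cons (.var 0) .nil) (x := TreeWhile.encodeGraph G)
    (by intro s hs; simp [TreeWhile.Exp.eval, hs])).seq (hr.seq (TreeWhile.Run.assign
      (e := .hd (.var 0)) (y := TreeWhile.encodeSet (VertexCover.minCover (VertexCover.adj G)))
      (by intro s hs; simp [TreeWhile.Exp.eval, hs, TreeWhile.Data.hd])))
  refine ⟨_, _, ⟨_, hrun _ (by simp [TreeWhile.initial]), by simp⟩,
    VertexCover.cov_adj_iff.1 h1, by rw [h2, VertexCover.vertexCoverNum_eq], ?_⟩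
  rw [VertexCover.vertexCoverNum_eq, ENat.toNat_natCast]
  have hlp : VertexCover.lp (VertexCover.adj G) ≤
      2 * VertexCover.coverNum (VertexCover.adj G) := by
    have := (VertexCover.hasVC_coverNum (VertexCover.adj G)).lp_le
    omega
  have hfrac := VertexCover.fractionalVertexCoverNum_le G
  have hfib := VertexCover.fib_le_rpow (2 * VertexCover.coverNum (VertexCover.adj G) + 2 -
    VertexCover.lp (VertexCover.adj G))
  simp only [TreeWhile.Exp.time, VertexCover.totalPot] at ht ⊢
  generalize VertexCover.lp (VertexCover.adj G) = l at *
  generalize VertexCover.coverNum (VertexCover.adj G) = k at *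
  have hpos := Nat.fib_pos.2 (Nat.succ_pos (2 * k + 2 - l))
  rw [Nat.cast_sub (by omega)] at hfib
  have hle : (2.6181 : ℝ) ^ (((2 * k + 2 : ℕ) - l : ℝ) / 2) ≤
      3 * (2.6181 : ℝ) ^ ((k : ℝ) - G.fractionalVertexCoverNum) := by
    calc (2.6181 : ℝ) ^ (((2 * k + 2 : ℕ) - l : ℝ) / 2)
        ≤ (2.6181 : ℝ) ^ (((k : ℝ) - G.fractionalVertexCoverNum) + 1) := by
          refine Real.rpow_le_rpow_of_exponent_le (by norm_num) ?_
          push_cast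
          linarith
      _ = (2.6181 : ℝ) ^ ((k : ℝ) - G.fractionalVertexCoverNum) * 2.6181 :=
          Real.rpow_add_one (by norm_num) _
      _ ≤ _ := by
          have := Real.rpow_pos_of_pos (show (0 : ℝ) < 2.6181 by norm_num)
            ((k : ℝ) - G.fractionalVertexCoverNum)
          linarith
  generalize Nat.fib (2 * k + 2 - l + 1) = F at *
  have htime : 1 + 1 + 1 + 1 + (t + (1 + 1 + 1)) ≤
      (q.eval n + 10) * (2 * ((n + 1) * F)) := by
    have hF : 1 ≤ (n + 1) * F := Nat.mul_pos (Nat.succ_pos n) hpos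
    generalize (n + 1) * F = f at *
    nlinarith [Nat.mul_le_mul_left (q.eval n) hF]
  calc ((1 + 1 + 1 + 1 + (t + (1 + 1 + 1)) : ℕ) : ℝ)
      ≤ (((q.eval n + 10) * (2 * ((n + 1) * F)) : ℕ) : ℝ) := Nat.cast_le.2 htime
    _ = ((q.eval n + 10) * (2 * (n + 1))) * (F : ℝ) := by push_cast; ring
    _ ≤ ((q.eval n + 10) * (2 * (n + 1))) *
        (3 * (2.6181 : ℝ) ^ ((k : ℝ) - G.fractionalVertexCoverNum)) :=
      mul_le_mul_of_nonneg_left (hfib.trans hle) (by positivity)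
    _ = _ := by
      simp only [Polynomial.eval_mul, Polynomial.eval_add, Polynomial.eval_ofNat,
        Polynomial.eval_X, Polynomial.eval_one]
      push_cast
      ring
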